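/- Let $M$ be a smooth (Hausdorff, second countable, finite-dimensional) manifold with a (real) Poisson structure $\{\cdot,\cdot\}$, and let $C^\infty(M)$ be the algebra of complex-valued smooth functions on $M$. A star product on $M$ is a $\mathbb C[[\lambda]]$-bilinear associative product $\star$ on $C^\infty(M)[[\lambda]]$ such that $f\star g=\sum_{r\ge 0}\lambda^r C_r(f,g)$ for $f,g\in C^\infty(M)$, where the $C_r$ are bidifferential operators, $C_0(f,g)=fg$ and $C_1(f,g)-C_1(g,f)=i\{f,g\}$. It is Hermitian if $\overline{f\star g}=\overline g\star\overline f$ (with $\overline\lambda=\lambda$); then $(C^\infty(M)[[\lambda]],\star)$ is a unital $^*$-algebra over $\mathbb C[[\lambda]]$ with involution complex conjugation. Order $\mathbb R[[\lambda]]$ by calling a nonzero series positive if its lowest nonvanishing coefficient is positive; for $z\in\mathbb C[[\lambda]]$, $z\ge 0$ ($z>0$) means that $z$ lies in $\mathbb R[[\lambda]]$ and is nonnegative (positive) there. A linear functional $\omega$ on a $^*$-algebra $\mathcal A$ over $\mathbb C[[\lambda]]$ is positive if $\omega(a^*a)\ge 0$ for all $a\in\mathcal A$, and $a\in\mathcal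 A$ is positive if $\omega(a)\ge0$ for all positive linear functionals $\omega$. A pre-Hilbert space over $\mathbb C[[\lambda]]$ is a $\mathbb C[[\lambda]]$-module $H$ with a sesquilinear map $\langle\cdot,\cdot\rangle:H\times H\to\mathbb C[[\lambda]]$, linear in the second argument, such that $\overline{\langle\psi,\phi\rangle}=\langle\phi,\psi\rangle$ and $\langle\phi,\phi\rangle>0$ for $\phi\ne0$. A $^*$-representation $(H,\pi)$ of $\mathcal A$ is a $^*$-homomorphism $\pi$ from $\mathcal A$ to the adjointable endomorphisms of a pre-Hilbert space $H$. Unital $^*$-algebras $\mathcal A,\mathcal B$ over $\mathbb C[[\lambda]]$ are strongly Morita equivalent if there is a $(\mathcal B,\mathcal A)$-bimodule $\mathcal E$ (with compatible $\mathbb C[[\lambda]]$-module structure) with a $\mathbb C[[\lambda]]$-sesquilinear map $\langle\cdot,\cdot\rangle:\mathcal E\times\mathcal E\to\mathcal A$, linear in the second argument, and a $\mathbb C[[\lambda]]$-sesquilinear map $\Theta:\mathcal E\times\mathcal E\to\mathcal B$, linear in the first argument, such that for all $x,y,z\in\mathcal E$, $a\in\mathcal A$, $b\in\mathcal B$: 1.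 $\langle x,y\rangle=\langle y,x\rangle^*$, $\langle x,y\cdot a\rangle=\langle x,y\rangle a$, $\langle b\cdot x,y\rangle=\langle x,b^*\cdot y\rangle$, and $\langle x,x\rangle$ is positive in $\mathcal A$; 2. $\Theta_{x,y}=\Theta_{y,x}^*$, $\Theta_{b\cdot x,y}=b\,\Theta_{x,y}$, $\Theta_{x,y\cdot a}=\Theta_{x\cdot a^*,y}$, and $\Theta_{x,x}$ is positive in $\mathcal B$; 3. $\Theta_{x,y}\cdot z=x\cdot\langle y,z\rangle$; 4. the elements $\langle x,y\rangle$ span $\mathcal A$ and the elements $\Theta_{x,y}$ span $\mathcal B$ over $\mathbb C[[\lambda]]$; 5. for every $^*$-representation $(H,\pi)$ of $\mathcal A$, the inner product $\langle x\otimes\phi,y\otimes\psi\rangle=\langle\phi,\pi(\langle x,y\rangle)\psi\rangle$ on $\mathcal E\otimes_{\mathcal A}H$ is positive semi-definite. **Theorem.** Let $\star$ and $\star'$ be Hermitian star products on the Poisson manifold $M$. Then $(C^\infty(M)[[\lambda]],\star)$ and $(C^\infty(M)[[\lambda]],\star')$ are strongly Morita equivalent as $^*$-algebras over $\mathbb C[[\lambda]]$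 if and only if they are Morita equivalent as unital $\mathbb C[[\lambda]]$-algebras, i.e. their categories of left modules are equivalent by a $\mathbb C[[\lambda]]$-linear equivalence. -/

import Mathlib

open scoped Manifold ContDiff PowerSeries
open MulOpposite (op)

universe u

/-! ## Complex-valued smooth functions -/

instance : ContMDiffRing 𝓘(ℝ, ℂ) ∞ ℂ :=
  { (inferInstance : LieAddGroup 𝓘(ℝ, ℂ) ∞ ℂ) with
    contMDiff_mul := by
      rw [contMDiff_iff]
      refine ⟨continuous_mul, fun x y => ?_⟩
      simp only [mfld_simps, chartAt_self_eq]
      rw [contDiffOn_univ]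
      exact contDiff_mul }

/-- The commutative algebra of smooth complex-valued functions on the `n`-dimensional
manifold `M`. -/
abbrev SmoothFun (n : ℕ) (M : Type u) [TopologicalSpace M]
    [ChartedSpace (EuclideanSpace ℝ (Fin n)) M] : Type u :=
  C^∞⟮𝓡 n, M; 𝓘(ℝ, ℂ), ℂ⟯

namespace SmoothFun

/-- Constant functions. -/
noncomputable def constHom (n : ℕ) (M : Type u) [TopologicalSpace M]
    [ChartedSpace (EuclideanSpace ℝ (Fin n)) M] : ℂ →+* SmoothFun n M where
  toFun c := ContMDiffMap.const c
  map_one' := rfl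
  map_mul' _ _ := rfl
  map_zero' := rfl
  map_add' _ _ := rfl

noncomputable instance instAlgebraComplex {n : ℕ} {M : Type u} [TopologicalSpace M]
    [ChartedSpace (EuclideanSpace ℝ (Fin n)) M] : Algebra ℂ (SmoothFun n M) :=
  (constHom n M).toAlgebra

/-- Pointwise complex conjugation. -/
noncomputable instance instStarRing {n : ℕ} {M : Type u} [TopologicalSpace M]
    [ChartedSpace (EuclideanSpace ℝ (Fin n)) M] : StarRing (SmoothFun n M) where
  star f := ⟨fun x => star (f x),
    (starL' ℝ (A := ℂ)).toContinuousLinearMap.contMDiff.comp f.contMDiff⟩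
  star_involutive f := by
    ext x
    exact star_star (f x)
  star_mul f g := by
    ext x
    exact star_mul (f x) (g x)
  star_add f g := by
    ext x
    exact star_add (f x) (g x)

theorem smul_apply {n : ℕ} {M : Type u} [TopologicalSpace M]
    [ChartedSpace (EuclideanSpace ℝ (Fin n)) M] (c : ℂ) (f : SmoothFun n M) (x : M) :
    (c • f) x = c * f x := rfl

theorem star_apply {n : ℕ} {M : Type u} [TopologicalSpace M]
    [ChartedSpace (EuclideanSpace ℝ (Fin n)) M] (f : SmoothFun n M) (x : M) :
    (star f) x = star (f x) := rfl

instance instStarModule {n : ℕ} {M : Type u} [TopologicalSpace M]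
    [ChartedSpace (EuclideanSpace ℝ (Fin n)) M] : StarModule ℂ (SmoothFun n M) where
  star_smul c f := by
    ext x
    simp [star_apply, smul_apply]

end SmoothFun

/-- A (real) Poisson structure on the manifold `M`, given by its Poisson bracket
`{f, g} = π₀(df, dg)` on complex-valued smooth functions: an alternating `ℂ`-bilinear biderivation
satisfying the Jacobi identity which is real, i.e. commutes with complex conjugation. -/
structure PoissonStructure (n : ℕ) (M : Type u) [TopologicalSpace M]
    [ChartedSpace (EuclideanSpace ℝ (Fin n)) M] where
  bracket : SmoothFun n M →ₗ[ℂ] SmoothFun n M →ₗ[ℂ] SmoothFun n M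
  bracket_self : ∀ f, bracket f f = 0
  leibniz : ∀ f g h, bracket f (g * h) = bracket f g * h + g * bracket f h
  jacobi : ∀ f g h,
    bracket f (bracket g h) + bracket g (bracket h f) + bracket h (bracket f g) = 0
  real : ∀ f g, star (bracket f g) = bracket (star f) (star g)

/-! ## Differential and bidifferential operators -/

/-- `D` is a linear differential operator of order at most `k` on the commutative algebra `A`:
its `(k+1)`-fold iterated commutators with multiplication operators vanish.  For the algebra of
smooth functions on a manifold these are the usual differential operators. -/
def IsDiffOp {A : Type u} [CommRing A] [Algebra ℂ A] : ℕ → (A →ₗ[ℂ] A) → Prop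
  | 0, D => ∀ a f, D (a * f) = a * D f
  | k + 1, D => ∀ a, IsDiffOp k (D ∘ₗ LinearMap.mulLeft ℂ a - LinearMap.mulLeft ℂ a ∘ₗ D)

/-- A bidifferential operator: a bilinear map that is a differential operator in each argument,
of bounded order. -/
def IsBidiffOp {A : Type u} [CommRing A] [Algebra ℂ A] (D : A →ₗ[ℂ] A →ₗ[ℂ] A) : Prop :=
  ∃ k : ℕ, (∀ g, IsDiffOp k (D.flip g)) ∧ ∀ f, IsDiffOp k (D f)

/-! ## Star products -/

/-- A star product on the Poisson manifold `(M, P)`: a `ℂ⟦λ⟧`-bilinear associative product on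
`C^∞(M)⟦λ⟧` with `f ⋆ g = ∑ λ^r C_r(f, g)` for `f, g ∈ C^∞(M)`, where the `C_r` are
bidifferential operators, `C_0(f, g) = f g` and `C_1(f, g) - C_1(g, f) = i {f, g}`. -/
structure StarProduct {n : ℕ} {M : Type u} [TopologicalSpace M]
    [ChartedSpace (EuclideanSpace ℝ (Fin n)) M] (P : PoissonStructure n M) where
  mul : (SmoothFun n M)⟦X⟧ →ₗ[ℂ⟦X⟧] (SmoothFun n M)⟦X⟧ →ₗ[ℂ⟦X⟧] (SmoothFun n M)⟦X⟧
  mul_assoc' : ∀ f g h, mul (mul f g) h = mul f (mul g h)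
  coef : ℕ → SmoothFun n M →ₗ[ℂ] SmoothFun n M →ₗ[ℂ] SmoothFun n M
  mul_C_C : ∀ f g : SmoothFun n M,
    mul (PowerSeries.C f) (PowerSeries.C g) = PowerSeries.mk fun r => coef r f g
  bidiff : ∀ r, IsBidiffOp (coef r)
  coef_zero : ∀ f g, coef 0 f g = f * g
  coef_one : ∀ f g, coef 1 f g - coef 1 g f = Complex.I • P.bracket f g

/-- Formal power series over a commutative `*`-ring form a `*`-ring, with the coefficientwise
involution (the formal parameter is self-adjoint). -/
noncomputable instance PowerSeries.instStarRingCoeff {R : Type*} [CommRing R] [StarRing R] :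
    StarRing R⟦X⟧ where
  star f := PowerSeries.map (starRingEnd R) f
  star_involutive f := by
    ext k
    simp
  star_mul f g := by
    rw [map_mul, mul_comm]
  star_add f g := map_add _ f g

theorem PowerSeries.coeff_star {R : Type*} [CommRing R] [StarRing R] (k : ℕ) (f : R⟦X⟧) :
    PowerSeries.coeff k (star f) = star (PowerSeries.coeff k f) := by
  change PowerSeries.coeff k (PowerSeries.map (starRingEnd R) f) = _
  simp [starRingEnd_apply]

/-- A star product is Hermitian if `conj (f ⋆ g) = conj g ⋆ conj f`. -/
structure HermitianStarProduct {n : ℕ} {M : Type u} [TopologicalSpace M]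
    [ChartedSpace (EuclideanSpace ℝ (Fin n)) M] (P : PoissonStructure n M)
    extends StarProduct P where
  hermitian : ∀ f g, star (mul f g) = mul (star g) (star f)

/-! ### The unit of a star product -/

section Unit

variable {A : Type u} [CommRing A] [Algebra ℂ A]

theorem PowerSeries.formal_smul_def (c : ℂ⟦X⟧) (f : A⟦X⟧) :
    c • f = PowerSeries.map (algebraMap ℂ A) c * f := rfl

theorem PowerSeries.X_smul_formal (f : A⟦X⟧) :
    (PowerSeries.X : ℂ⟦X⟧) • f = PowerSeries.X * f := by
  rw [PowerSeries.formal_smul_def, PowerSeries.map_X]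

theorem PowerSeries.eq_C_add_X_smul (f : A⟦X⟧) :
    ∃ g : A⟦X⟧, f = PowerSeries.C (PowerSeries.constantCoeff f) + (PowerSeries.X : ℂ⟦X⟧) • g := by
  refine ⟨PowerSeries.mk fun k => PowerSeries.coeff (k + 1) f, ?_⟩
  rw [PowerSeries.X_smul_formal]
  ext k
  cases k with
  | zero => simp
  | succ k => simp [PowerSeries.coeff_succ_X_mul]

/-- A `ℂ⟦λ⟧`-linear endomorphism that is the identity modulo `λ` is bijective. -/
theorem PowerSeries.bijective_of_id_mod (L : A⟦X⟧ →ₗ[ℂ⟦X⟧] A⟦X⟧)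
    (hL : ∀ f, PowerSeries.constantCoeff (L f) = PowerSeries.constantCoeff f) :
    Function.Bijective L := by
  have hX : ∀ f g : A⟦X⟧, (PowerSeries.X : ℂ⟦X⟧) • f = (PowerSeries.X : ℂ⟦X⟧) • g → f = g := by
    intro f g h
    rw [PowerSeries.X_smul_formal, PowerSeries.X_smul_formal] at h
    ext k
    have := congrArg (PowerSeries.coeff (k + 1)) h
    simpa [PowerSeries.coeff_succ_X_mul] using this
  constructor
  · rw [injective_iff_map_eq_zero]
    have key : ∀ k : ℕ, ∀ f, L f = 0 → PowerSeries.coeff k f = 0 := by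
      intro k
      induction k with
      | zero =>
        intro f hf
        have := hL f
        rw [hf] at this
        simpa using this.symm
      | succ k ih =>
        intro f hf
        obtain ⟨g, hg⟩ := PowerSeries.eq_C_add_X_smul f
        have h0 : PowerSeries.constantCoeff f = 0 := by
          rw [← hL f, hf, map_zero]
        rw [h0, map_zero, zero_add] at hg
        have h1 : L g = 0 := by
          apply hX
          rw [← map_smul, ← hg, hf, smul_zero]
        rw [hg, PowerSeries.X_smul_formal, PowerSeries.coeff_succ_X_mul]
        exact ih g h1
    intro f hf
    ext k
    simpa using key k f hf
  · have hN : ∀ f, ∃ g, f - L f = (PowerSeries.X : ℂ⟦X⟧) • g := by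
      intro f
      obtain ⟨g, hg⟩ := PowerSeries.eq_C_add_X_smul (f - L f)
      refine ⟨g, ?_⟩
      rw [map_sub, hL f, sub_self, map_zero, zero_add] at hg
      exact hg
    choose N hN using hN
    let Z : A⟦X⟧ → A⟦X⟧ := fun f =>
      PowerSeries.mk fun k => ∑ j ∈ Finset.range (k + 1), PowerSeries.coeff (k - j) (N^[j] f)
    have hZ : ∀ f, Z f = f + (PowerSeries.X : ℂ⟦X⟧) • Z (N f) := by
      intro f
      rw [PowerSeries.X_smul_formal]
      ext k
      cases k with
      | zero => simp [Z]
      | succ k =>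
        simp only [Z, map_add, PowerSeries.coeff_succ_X_mul, PowerSeries.coeff_mk]
        rw [Finset.sum_range_succ' _ (k + 1), add_comm]
        simp [Function.iterate_succ_apply]
    have hW : ∀ f, L (Z f) - f = (PowerSeries.X : ℂ⟦X⟧) • (L (Z (N f)) - N f) := by
      intro f
      have h1 : L (Z f) = L f + (PowerSeries.X : ℂ⟦X⟧) • L (Z (N f)) := by
        conv_lhs => rw [hZ f]
        rw [map_add, map_smul]
      rw [h1, smul_sub, ← hN f]
      abel
    have hW0 : ∀ k : ℕ, ∀ f, PowerSeries.coeff k (L (Z f) - f) = 0 := by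
      intro k
      induction k with
      | zero =>
        intro f
        rw [hW f, PowerSeries.X_smul_formal]
        simp
      | succ k ih =>
        intro f
        rw [hW f, PowerSeries.X_smul_formal, PowerSeries.coeff_succ_X_mul]
        exact ih (N f)
    intro f
    refine ⟨Z f, sub_eq_zero.mp ?_⟩
    ext k
    simpa using hW0 k f

end Unit

namespace StarProduct

variable {n : ℕ} {M : Type u} [TopologicalSpace M]
  [ChartedSpace (EuclideanSpace ℝ (Fin n)) M] {P : PoissonStructure n M}

theorem constantCoeff_mul (S : StarProduct P) (f g : (SmoothFun n M)⟦X⟧) :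
    PowerSeries.constantCoeff (S.mul f g) =
      PowerSeries.constantCoeff f * PowerSeries.constantCoeff g := by
  obtain ⟨f', hf⟩ := PowerSeries.eq_C_add_X_smul f
  obtain ⟨g', hg⟩ := PowerSeries.eq_C_add_X_smul g
  have hX : ∀ h : (SmoothFun n M)⟦X⟧,
      PowerSeries.constantCoeff ((PowerSeries.X : ℂ⟦X⟧) • h) = 0 := by
    intro h
    rw [PowerSeries.X_smul_formal]
    simp
  have h1 : ∀ h, PowerSeries.constantCoeff (S.mul ((PowerSeries.X : ℂ⟦X⟧) • f') h) = 0 := by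
    intro h
    rw [LinearMap.map_smul₂, hX]
  have h2 : ∀ h, PowerSeries.constantCoeff (S.mul h ((PowerSeries.X : ℂ⟦X⟧) • g')) = 0 := by
    intro h
    rw [LinearMap.map_smul, hX]
  conv_lhs => rw [hf, hg]
  rw [map_add, LinearMap.map_add₂, map_add, map_add, h1, h2, S.mul_C_C, add_zero, add_zero,
    ← PowerSeries.coeff_zero_eq_constantCoeff_apply (PowerSeries.mk _), PowerSeries.coeff_mk,
    S.coef_zero]

/-- Every star product has a two-sided unit (which need not be the constant function `1`). -/
theorem exists_unit (S : StarProduct P) :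
    ∃ e, ∀ f, S.mul e f = f ∧ S.mul f e = f := by
  obtain ⟨hli, hls⟩ := PowerSeries.bijective_of_id_mod (S.mul 1) (fun f => by
    rw [S.constantCoeff_mul]; simp)
  obtain ⟨hri, hrs⟩ := PowerSeries.bijective_of_id_mod (S.mul.flip 1) (fun f => by
    rw [LinearMap.flip_apply, S.constantCoeff_mul]; simp)
  obtain ⟨e, he⟩ := hls 1
  obtain ⟨e', he'⟩ := hrs 1
  rw [LinearMap.flip_apply] at he'
  have h1 : ∀ f, S.mul e f = f := fun f => hli (by rw [← S.mul_assoc', he])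
  have h2 : ∀ f, S.mul f e' = f := fun f => hri (by
    rw [LinearMap.flip_apply, LinearMap.flip_apply, S.mul_assoc', he'])
  have h3 : e = e' := by rw [← h2 e, h1 e']
  exact ⟨e, fun f => ⟨h1 f, by rw [h3]; exact h2 f⟩⟩

/-- The underlying space `C^∞(M)⟦λ⟧` of the star product algebra `(C^∞(M)⟦λ⟧, ⋆)`. -/
def Alg (_S : StarProduct P) : Type u := (SmoothFun n M)⟦X⟧

noncomputable instance (S : StarProduct P) : AddCommGroup S.Alg :=
  inferInstanceAs (AddCommGroup (SmoothFun n M)⟦X⟧)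

noncomputable instance (S : StarProduct P) : Module ℂ⟦X⟧ S.Alg :=
  inferInstanceAs (Module ℂ⟦X⟧ (SmoothFun n M)⟦X⟧)

/-- The ring `(C^∞(M)⟦λ⟧, ⋆)`. -/
noncomputable instance (S : StarProduct P) : Ring S.Alg where
  __ := (inferInstance : AddCommGroup S.Alg)
  mul f g := S.mul f g
  one := S.exists_unit.choose
  mul_assoc := S.mul_assoc'
  one_mul f := (S.exists_unit.choose_spec f).1
  mul_one f := (S.exists_unit.choose_spec f).2
  zero_mul f := LinearMap.map_zero₂ S.mul f
  mul_zero f := (S.mul f).map_zero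
  left_distrib f g h := (S.mul f).map_add g h
  right_distrib f g h := LinearMap.map_add₂ S.mul f g h

noncomputable instance (S : StarProduct P) : Algebra ℂ⟦X⟧ S.Alg :=
  Algebra.ofModule (fun c f g => LinearMap.map_smul₂ S.mul c f g)
    (fun c f g => (S.mul f).map_smul c g)

end StarProduct

namespace HermitianStarProduct

variable {n : ℕ} {M : Type u} [TopologicalSpace M]
  [ChartedSpace (EuclideanSpace ℝ (Fin n)) M] {P : PoissonStructure n M}

/-- The star product algebra `(C^∞(M)⟦λ⟧, ⋆)` of a Hermitian star product. -/
abbrev Alg (S : HermitianStarProduct P) : Type u := S.toStarProduct.Alg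

/-- Complex conjugation of functions is an involution of the algebra `(C^∞(M)⟦λ⟧, ⋆)`. -/
noncomputable instance (S : HermitianStarProduct P) : StarRing S.Alg where
  star f := star (R := (SmoothFun n M)⟦X⟧) f
  star_involutive f := star_star (R := (SmoothFun n M)⟦X⟧) f
  star_mul := S.hermitian
  star_add f g := star_add (R := (SmoothFun n M)⟦X⟧) f g

instance (S : HermitianStarProduct P) : StarModule ℂ⟦X⟧ S.Alg where
  star_smul c f := by
    have h : ∀ (c : ℂ⟦X⟧) (f : (SmoothFun n M)⟦X⟧), star (c • f) = star c • star f := by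
      intro c f
      rw [PowerSeries.formal_smul_def, PowerSeries.formal_smul_def, star_mul, mul_comm]
      congr 1
    exact h c f

end HermitianStarProduct

/-! ## Positivity over `ℂ⟦λ⟧ = ℝ⟦λ⟧(i)` -/

/-- The ordering of the ordered ring `ℝ⟦λ⟧`: a formal power series is positive if its lowest
nonvanishing coefficient exists and is positive. -/
def RealFormalPos (a : ℝ⟦X⟧) : Prop :=
  ∃ k : ℕ, (∀ j < k, PowerSeries.coeff j a = 0) ∧ 0 < PowerSeries.coeff k a

/-- `0 < z` for `z ∈ ℂ⟦λ⟧`: `z` lies in `ℝ⟦λ⟧` and is positive there. -/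
def FormalPos (z : ℂ⟦X⟧) : Prop :=
  ∃ a : ℝ⟦X⟧, RealFormalPos a ∧ z = PowerSeries.map Complex.ofRealHom a

/-- `0 ≤ z` for `z ∈ ℂ⟦λ⟧`. -/
def FormalNonneg (z : ℂ⟦X⟧) : Prop := z = 0 ∨ FormalPos z

/-- A linear functional `τ` is positive if `τ(a* a) ≥ 0` for all `a`. -/
def IsPositiveFunctional {A : Type u} [Ring A] [Algebra ℂ⟦X⟧ A] [StarRing A]
    (τ : A →ₗ[ℂ⟦X⟧] ℂ⟦X⟧) : Prop :=
  ∀ a : A, FormalNonneg (τ (star a * a))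

/-- An element `a` is positive if `τ(a) ≥ 0` for all positive linear functionals `τ`. -/
def IsPositiveElement {A : Type u} [Ring A] [Algebra ℂ⟦X⟧ A] [StarRing A] (a : A) : Prop :=
  ∀ τ : A →ₗ[ℂ⟦X⟧] ℂ⟦X⟧, IsPositiveFunctional τ → FormalNonneg (τ a)

/-! ## `*`-representations and strong Morita equivalence -/

/-- A pre-Hilbert space over `ℂ⟦λ⟧`: the inner product is linear in the second argument. -/
structure FormalPreHilbert (H : Type u) [AddCommGroup H] [Module ℂ⟦X⟧ H] where
  inner : H →ₗ⋆[ℂ⟦X⟧] H →ₗ[ℂ⟦X⟧] ℂ⟦X⟧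
  conj_symm : ∀ φ ψ, star (inner ψ φ) = inner φ ψ
  pos_def : ∀ φ, φ ≠ 0 → FormalPos (inner φ φ)

/-- A `*`-representation of the `*`-algebra `A` over `ℂ⟦λ⟧` on a pre-Hilbert space: an algebra
homomorphism to the adjointable endomorphisms with `π(a*)` the adjoint of `π(a)`. -/
structure FormalStarRep (A : Type u) [Ring A] [Algebra ℂ⟦X⟧ A] [StarRing A]
    {H : Type u} [AddCommGroup H] [Module ℂ⟦X⟧ H] (ip : FormalPreHilbert H) where
  toHom : A →ₙₐ[ℂ⟦X⟧] Module.End ℂ⟦X⟧ H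
  adjoint : ∀ a φ ψ, ip.inner φ (toHom a ψ) = ip.inner (toHom (star a) φ) ψ

/-- The structure of a (`*`-)equivalence bimodule on the `(B, A)`-bimodule `E`: full Hermitian
inner products with values in `A` (linear in the second argument) and in `B` (linear in the first
argument), which are compatible, such that the inner product
`⟨x ⊗ φ, y ⊗ ψ⟩ = ⟨φ, π(⟨x, y⟩) ψ⟩` on `E ⊗[A] H` is positive semi-definite for every
`*`-representation `(H, π)` of `A`. -/
structure StrongEquivalenceBimodule (B A : Type u)
    [Ring B] [Algebra ℂ⟦X⟧ B] [StarRing B] [Ring A] [Algebra ℂ⟦X⟧ A] [StarRing A]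
    (E : Type u) [AddCommGroup E] [Module ℂ⟦X⟧ E] [Module B E] [Module Aᵐᵒᵖ E] where
  innerA : E →ₗ⋆[ℂ⟦X⟧] E →ₗ[ℂ⟦X⟧] A
  innerA_conj_symm : ∀ x y, star (innerA y x) = innerA x y
  innerA_smul_right : ∀ x y (a : A), innerA x (op a • y) = innerA x y * a
  innerA_pos : ∀ x, IsPositiveElement (innerA x x)
  innerA_adjoint : ∀ (b : B) x y, innerA (b • x) y = innerA x (star b • y)
  innerB : E →ₗ[ℂ⟦X⟧] E →ₗ⋆[ℂ⟦X⟧] B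
  innerB_conj_symm : ∀ x y, star (innerB y x) = innerB x y
  innerB_smul_left : ∀ (b : B) x y, innerB (b • x) y = b * innerB x y
  innerB_pos : ∀ x, IsPositiveElement (innerB x x)
  innerB_adjoint : ∀ x y (a : A), innerB x (op a • y) = innerB (op (star a) • x) y
  compatible : ∀ x y z, innerB x y • z = op (innerA y z) • x
  fullA : Submodule.span ℂ⟦X⟧ {a : A | ∃ x y, innerA x y = a} = ⊤
  fullB : Submodule.span ℂ⟦X⟧ {b : B | ∃ x y, innerB x y = b} = ⊤
  /- A general element of `E ⊗[A] H` is `∑ i, x i ⊗ φ i`. -/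
  tensor_nonneg : ∀ (H : Type u) [AddCommGroup H] [Module ℂ⟦X⟧ H] (ip : FormalPreHilbert H)
    (π : FormalStarRep A ip) (m : ℕ) (x : Fin m → E) (φ : Fin m → H),
    FormalNonneg (∑ i, ∑ j, ip.inner (φ i) (π.toHom (innerA (x i) (x j)) (φ j)))

/-- Strong Morita equivalence of unital `*`-algebras over `ℂ⟦λ⟧`: existence of an equivalence
bimodule. -/
def StronglyMoritaEquivalent (A B : Type u)
    [Ring A] [Algebra ℂ⟦X⟧ A] [StarRing A] [Ring B] [Algebra ℂ⟦X⟧ B] [StarRing B] : Prop :=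
  ∃ (E : Type u) (_ : AddCommGroup E) (_ : Module ℂ⟦X⟧ E) (_ : Module B E) (_ : Module Aᵐᵒᵖ E)
    (_ : IsScalarTower ℂ⟦X⟧ B E) (_ : IsScalarTower ℂ⟦X⟧ Aᵐᵒᵖ E) (_ : SMulCommClass B Aᵐᵒᵖ E),
    Nonempty (StrongEquivalenceBimodule B A E)

/-!
A Morita equivalence is given by a progenerator `E` of `B` together with an identification of `Aᵒᵖ`
with `End E`. Invertibility of a matrix over `B` can be tested in the classical limit, so matrices
`1 + a a⋆` are invertible; by an argument of Kaplansky idempotent matrices may be taken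
self-adjoint, and `E` carries a full Hermitian form for which it has a self-dual frame.
It remains to correct two defects.

* The sum of the values of the form on the frame is `1` only in the classical limit, where `E` has
  rank one because `A` is commutative there. Rescaling by its formal square root, the form takes
  the value `1` on a sum of squares.
* The identification need not match the involution of `A` with the adjoint. Classically it does,
  because homomorphisms between algebras of functions preserve conjugation. So comparing it with
  its conjugate gives an automorphism of `A` congruent to the identity modulo `λ`; composing the
  identification with the formal square root of this automorphism makes it a `*`-isomorphism.

Both inner products are then sums of squares, which gives all the positivity requirements.
-/

/-! ## Complete modules and formal square roots -/

section AdicComplete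

open scoped TensorProduct

section Ideal

variable {R V W : Type*} [CommRing R] [AddCommGroup V] [Module R V] [AddCommGroup W] [Module R W]
  (I : Ideal R)

variable {I} in
theorem smodEq_apply {x y : V} (h : x ≡ y [SMOD (I • ⊤ : Submodule R V)]) (f : V →ₗ[R] W) :
    f x ≡ f y [SMOD (I • ⊤ : Submodule R W)] :=
  (h.map f).mono <| by
    rw [Submodule.map_smul'']
    exact Submodule.smul_mono le_rfl le_top

theorem existsUnique_fixedPoint [IsAdicComplete I V] {Φ : V → V}
    (hΦ : ∀ n x y, x ≡ y [SMOD (I ^ n • ⊤ : Submodule R V)] →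
      Φ x ≡ Φ y [SMOD (I ^ (n + 1) • ⊤ : Submodule R V)]) :
    ∃! x, Φ x = x := by
  have antitone {m n : ℕ} (h : m ≤ n) : (I ^ n • ⊤ : Submodule R V) ≤ I ^ m • ⊤ :=
    Submodule.smul_mono_left (Ideal.pow_le_pow_right h)
  have iterate_smodEq (n : ℕ) (x y : V) : Φ^[n] x ≡ Φ^[n] y [SMOD (I ^ n • ⊤ : Submodule R V)] := by
    induction n with
    | zero => simp
    | succ n ih => simpa only [Function.iterate_succ_apply'] using hΦ n _ _ ih
  obtain ⟨x, hx⟩ := IsPrecomplete.prec (I := I) inferInstance (f := fun n => Φ^[n] 0)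
    fun {m n} hmn => by
      obtain ⟨k, rfl⟩ := Nat.exists_eq_add_of_le hmn
      simpa only [Function.iterate_add_apply] using iterate_smodEq m 0 _
  refine ⟨x, ?_, fun y hy => ?_⟩
  · refine IsHausdorff.eq_iff_smodEq (I := I).2 fun n => ?_
    have := (hΦ n _ _ (hx n)).symm.trans (U := I ^ (n + 1) • ⊤)
      (by simpa only [Function.iterate_succ_apply'] using hx (n + 1))
    exact this.mono (antitone n.le_succ)
  · refine IsHausdorff.eq_iff_smodEq (I := I).2 fun n => ?_
    have := iterate_smodEq n y 0
    rw [Function.iterate_fixed hy] at this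
    exact this.trans (hx n)

theorem bijective_of_smodEq_id [IsAdicComplete I V] {L : Module.End R V}
    (hL : ∀ x, L x ≡ x [SMOD (I • ⊤ : Submodule R V)]) : Function.Bijective L := by
  have range_le : LinearMap.range (LinearMap.id - L) ≤ I • ⊤ := by
    rintro _ ⟨x, rfl⟩
    exact SModEq.sub_mem.1 (hL x).symm
  refine Function.bijective_iff_existsUnique L |>.2 fun y => ?_
  have := existsUnique_fixedPoint I (V := V)
    (Φ := fun x => (LinearMap.id - L : Module.End R V) x + y) fun n x x' h => by
    rw [SModEq.sub_mem] at h ⊢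
    rw [add_sub_add_right_eq_sub, ← map_sub, pow_succ, mul_smul]
    refine Submodule.smul_mono le_rfl range_le ?_
    rw [← Submodule.map_top, ← Submodule.map_smul'']
    exact Submodule.mem_map_of_mem h
  refine (existsUnique_congr fun x => ?_).1 this
  rw [LinearMap.sub_apply, LinearMap.id_apply, sub_add_eq_add_sub, sub_eq_iff_eq_add,
    add_right_inj, eq_comm]

theorem eq_of_sq_apply_eq_of_commute [Invertible (2 : R)] [IsAdicComplete I V]
    {L L' : Module.End R V} (hL : ∀ x, L x ≡ x [SMOD (I • ⊤ : Submodule R V)])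
    (hL' : ∀ x, L' x ≡ x [SMOD (I • ⊤ : Submodule R V)]) (hLL' : Commute L L') {v : V}
    (h : L (L v) = L' (L' v)) : L v = L' v := by
  have mean_bijective : Function.Bijective (⅟(2 : R) • (L + L')) :=
    bijective_of_smodEq_id I fun x => by
      have := ((hL x).add (hL' x)).smul ⅟(2 : R)
      rwa [← two_smul R x, invOf_smul_smul] at this
  refine mean_bijective.1 ?_
  have : L (L' v) = L' (L v) := LinearMap.congr_fun hLL' v
  simp only [LinearMap.smul_apply, LinearMap.add_apply, h, this, add_comm]

theorem isUnit_of_mul_smodEq_one {A : Type*} [Ring A] [Algebra R A] [IsAdicComplete I A] {a b : A}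
    (hab : a * b ≡ 1 [SMOD (I • ⊤ : Submodule R A)])
    (hba : b * a ≡ 1 [SMOD (I • ⊤ : Submodule R A)]) : IsUnit a := by
  obtain ⟨x, hx⟩ := (bijective_of_smodEq_id I (L := LinearMap.mulLeft R (a * b)) fun x => by
    simpa [mul_assoc] using smodEq_apply hab (LinearMap.mulRight R x)).2 1
  obtain ⟨y, hy⟩ := (bijective_of_smodEq_id I (L := LinearMap.mulRight R (b * a)) fun x => by
    simpa [mul_assoc] using smodEq_apply hba (LinearMap.mulLeft R x)).2 1
  exact isUnit_iff_exists_and_exists.2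
    ⟨⟨b * x, by rw [← mul_assoc]; exact hx⟩, ⟨y * b, by rw [mul_assoc]; exact hy⟩⟩

end Ideal

section Principal

variable {R : Type*} [CommRing R] {ℓ : R}

section Module

variable {V W : Type*} [AddCommGroup V] [Module R V] [AddCommGroup W] [Module R W]

theorem smodEq_span_singleton_pow_iff {n : ℕ} {x y : V} :
    x ≡ y [SMOD (Ideal.span {ℓ} ^ n • ⊤ : Submodule R V)] ↔ ∃ z, x = y + ℓ ^ n • z := by
  rw [SModEq.sub_mem, Ideal.span_singleton_pow, Submodule.ideal_span_singleton_smul,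
    Submodule.mem_smul_pointwise_iff_exists]
  simp only [Submodule.mem_top, true_and, eq_sub_iff_add_eq', eq_comm]

theorem smodEq_span_singleton_iff {x y : V} :
    x ≡ y [SMOD (Ideal.span {ℓ} • ⊤ : Submodule R V)] ↔ ∃ z, x = y + ℓ • z := by
  have := smodEq_span_singleton_pow_iff (ℓ := ℓ) (n := 1) (x := x) (y := y)
  rwa [pow_one, pow_one] at this

theorem eq_zero_of_forall_eq_smul_succ [IsHausdorff (Ideal.span {ℓ}) V] {s : ℕ → V}
    (hs : ∀ k, s k = ℓ • s (k + 1)) (k : ℕ) : s k = 0 := by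
  refine IsHausdorff.haus (I := Ideal.span {ℓ}) inferInstance _ fun n => ?_
  refine smodEq_span_singleton_pow_iff.2 ⟨s (k + n), ?_⟩
  induction n with
  | zero => simp
  | succ n ih => rw [ih, hs (k + n), smul_smul, pow_succ, add_assoc]

variable (ℓ) in
/-- Completeness expressed through the remainders `s k = ∑ j, ℓ ^ j • y (k + j)` of a series. -/
theorem isAdicComplete_span_singleton_iff :
    IsAdicComplete (Ideal.span {ℓ}) V ↔ IsHausdorff (Ideal.span {ℓ}) V ∧
      ∀ y : ℕ → V, ∃ s : ℕ → V, ∀ k, s k = y k + ℓ • s (k + 1) := by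
  constructor
  · intro h
    refine ⟨inferInstance, fun y => ?_⟩
    let partialSum (k n : ℕ) : V := ∑ j ∈ Finset.range n, ℓ ^ j • y (k + j)
    have partialSum_succ_left (k n : ℕ) :
        partialSum k (n + 1) = y k + ℓ • partialSum (k + 1) n := by
      simp only [partialSum, Finset.sum_range_succ', Finset.smul_sum, smul_smul, pow_succ',
        pow_zero, one_smul, add_zero, add_comm, add_left_comm]
    have partialSum_smodEq (k : ℕ) {m n : ℕ} (hmn : m ≤ n) :
        partialSum k m ≡ partialSum k n [SMOD (Ideal.span {ℓ} ^ m • ⊤ : Submodule R V)] := by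
      obtain ⟨d, rfl⟩ := Nat.exists_eq_add_of_le hmn
      refine (smodEq_span_singleton_pow_iff.2 ⟨partialSum (k + m) d, ?_⟩).symm
      simp only [partialSum, Finset.sum_range_add, Finset.smul_sum, smul_smul, pow_add, add_assoc]
    choose s hs using fun k => IsPrecomplete.prec (I := Ideal.span {ℓ}) inferInstance
      (fun {m n} hmn => partialSum_smodEq k (m := m) (n := n) hmn)
    refine ⟨s, fun k => IsHausdorff.eq_iff_smodEq (I := Ideal.span {ℓ}).2 fun n => ?_⟩
    refine (hs k n).symm.trans ((partialSum_smodEq k n.le_succ).trans ?_)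
    rw [partialSum_succ_left]
    exact (SModEq.refl _).add ((hs (k + 1) n).smul ℓ)
  · rintro ⟨hausdorff, exists_remainder⟩
    refine { hausdorff with prec' := fun f hf => ?_ }
    choose y hy using fun n : ℕ => smodEq_span_singleton_pow_iff.1 (hf n.le_succ)
    obtain ⟨s, hs⟩ := exists_remainder fun n => -y n
    refine ⟨f 0 + s 0, fun n => (smodEq_span_singleton_pow_iff.2 ⟨s n, ?_⟩).symm⟩
    induction n with
    | zero => simp
    | succ n ih => rw [ih, hy n, hs n]; module

instance isAdicComplete_pi {ι : Type*} [IsAdicComplete (Ideal.span {ℓ}) V] :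
    IsAdicComplete (Ideal.span {ℓ}) (ι → V) := by
  have exists_remainder := ((isAdicComplete_span_singleton_iff ℓ (V := V)).1 inferInstance).2
  refine (isAdicComplete_span_singleton_iff ℓ).2 ⟨⟨fun f hf => ?_⟩, fun y => ?_⟩
  · refine funext fun i => IsHausdorff.haus (I := Ideal.span {ℓ}) inferInstance _ fun n => ?_
    obtain ⟨g, hg⟩ := smodEq_span_singleton_pow_iff.1 (hf n)
    exact smodEq_span_singleton_pow_iff.2 ⟨g i, congrFun hg i⟩
  · choose s hs using fun i => exists_remainder fun k => y k i
    exact ⟨fun k i => s i k, fun k => funext fun i => hs i k⟩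

instance isAdicComplete_linearMap [IsAdicComplete (Ideal.span {ℓ}) V] :
    IsAdicComplete (Ideal.span {ℓ}) (W →ₗ[R] V) := by
  have exists_remainder := ((isAdicComplete_span_singleton_iff ℓ (V := V)).1 inferInstance).2
  refine (isAdicComplete_span_singleton_iff ℓ).2 ⟨⟨fun T hT => ?_⟩, fun y => ?_⟩
  · refine LinearMap.ext fun w => IsHausdorff.haus (I := Ideal.span {ℓ}) inferInstance _ fun n => ?_
    obtain ⟨U, hU⟩ := smodEq_span_singleton_pow_iff.1 (hT n)
    exact smodEq_span_singleton_pow_iff.2 ⟨U w, LinearMap.congr_fun hU w⟩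
  · choose s hs using fun w => exists_remainder fun k => y k w
    have s_add (k : ℕ) (v w : W) : s (v + w) k = s v k + s w k := by
      refine sub_eq_zero.1 (eq_zero_of_forall_eq_smul_succ (ℓ := ℓ)
        (s := fun k => s (v + w) k - (s v k + s w k)) (fun k => ?_) k)
      simp only [hs (v + w) k, hs v k, hs w k, map_add]
      module
    have s_smul (k : ℕ) (c : R) (w : W) : s (c • w) k = c • s w k := by
      refine sub_eq_zero.1 (eq_zero_of_forall_eq_smul_succ (ℓ := ℓ)
        (s := fun k => s (c • w) k - c • s w k) (fun k => ?_) k)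
      simp only [hs (c • w) k, hs w k, map_smul]
      module
    exact ⟨fun k => { toFun := fun w => s w k, map_add' := s_add k, map_smul' := s_smul k },
      fun k => LinearMap.ext fun w => hs w k⟩

theorem linearMap_smodEq_of_forall_apply (hℓ : IsSMulRegular V ℓ) {T T' : W →ₗ[R] V}
    (h : ∀ w, T w ≡ T' w [SMOD (Ideal.span {ℓ} • ⊤ : Submodule R V)]) :
    T ≡ T' [SMOD (Ideal.span {ℓ} • ⊤ : Submodule R (W →ₗ[R] V))] := by
  let mulByℓ : V ≃ₗ[R] LinearMap.range (LinearMap.lsmul R V ℓ) :=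
    LinearEquiv.ofInjective (LinearMap.lsmul R V ℓ) hℓ
  have mem_range (w : W) : (T - T') w ∈ LinearMap.range (LinearMap.lsmul R V ℓ) := by
    obtain ⟨z, hz⟩ := smodEq_span_singleton_iff.1 (h w)
    exact ⟨z, by simp [hz]⟩
  refine smodEq_span_singleton_iff.2
    ⟨mulByℓ.symm.toLinearMap ∘ₗ (T - T').codRestrict _ mem_range, ?_⟩
  ext w
  have := congrArg Subtype.val (mulByℓ.apply_symm_apply ⟨(T - T') w, mem_range w⟩)
  exact sub_eq_iff_eq_add'.1 this.symm

end Module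

section Algebra

variable {A : Type*} [Ring A] [Algebra R A]

theorem existsUnique_sq_eq [Invertible (2 : R)] [IsAdicComplete (Ideal.span {ℓ}) A] {a : A}
    (ha : a ≡ 1 [SMOD (Ideal.span {ℓ} • ⊤ : Submodule R A)]) :
    ∃! s : A, s ≡ 1 [SMOD (Ideal.span {ℓ} • ⊤ : Submodule R A)] ∧ s * s = a := by
  refine existsUnique_of_exists_of_unique ?_ ?_
  · obtain ⟨r, rfl⟩ := smodEq_span_singleton_iff.1 ha
    obtain ⟨x, hx, -⟩ := existsUnique_fixedPoint (Ideal.span {ℓ})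
      (Φ := fun x : A => ⅟(2 : R) • (r - ℓ • (x * x))) fun n x y hxy => by
        obtain ⟨z, rfl⟩ := smodEq_span_singleton_pow_iff.1 hxy
        refine smodEq_span_singleton_pow_iff.2
          ⟨-(⅟(2 : R) • (y * z + z * y + ℓ ^ n • (z * z))), ?_⟩
        simp only [mul_add, add_mul, mul_smul_comm, smul_mul_assoc]
        module
    have two_smul_x : (2 : R) • x = r - ℓ • (x * x) := by
      simpa only [smul_invOf_smul] using congrArg ((2 : R) • ·) hx.symm
    refine ⟨1 + ℓ • x, smodEq_span_singleton_iff.2 ⟨x, rfl⟩, ?_⟩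
    calc (1 + ℓ • x) * (1 + ℓ • x) = 1 + ℓ • ((2 : R) • x + ℓ • (x * x)) := by
          simp only [mul_add, add_mul, mul_smul_comm, smul_mul_assoc, one_mul, mul_one]
          module
      _ = 1 + ℓ • r := by rw [two_smul_x, sub_add_cancel]
  · rintro s t ⟨hs, hss⟩ ⟨ht, htt⟩
    have := eq_of_sq_apply_eq_of_commute (Ideal.span {ℓ}) (L := LinearMap.mulLeft R s)
      (L' := LinearMap.mulRight R t) (v := 1)
      (fun x => by simpa using smodEq_apply hs (LinearMap.mulRight R x))
      (fun x => by simpa using smodEq_apply ht (LinearMap.mulLeft R x))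
      (LinearMap.commute_mulLeft_right s t) (by simp [hss, htt])
    simpa using this

/-- `τ ∘ μ` and `μ ∘ (τ ⊗ τ)`, where `μ` is the multiplication, arise from `μ` by two commuting
operators with the same square, both congruent to the identity. -/
theorem map_mul_of_sq_eq [Invertible (2 : R)] [IsAdicComplete (Ideal.span {ℓ}) A]
    {τ : Module.End R A} (hτ : τ ≡ 1 [SMOD (Ideal.span {ℓ} • ⊤ : Submodule R (Module.End R A))])
    (hττ : ∀ a b, τ (τ (a * b)) = τ (τ a) * τ (τ b)) (a b : A) : τ (a * b) = τ a * τ b := by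
  have map_smodEq : TensorProduct.map τ τ ≡ LinearMap.id
      [SMOD (Ideal.span {ℓ} • ⊤ : Submodule R (Module.End R (A ⊗[R] A)))] := by
    have left := smodEq_apply hτ ((TensorProduct.mapBilinear (RingHom.id R) A A A A).flip τ)
    have right := smodEq_apply hτ (TensorProduct.mapBilinear (RingHom.id R) A A A A 1)
    exact TensorProduct.map_id (R := R) (M := A) (N := A) ▸ left.trans right
  have := eq_of_sq_apply_eq_of_commute (Ideal.span {ℓ}) (V := A ⊗[R] A →ₗ[R] A)
    (L := LinearMap.compRight R τ) (L' := LinearMap.lcomp R A (TensorProduct.map τ τ))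
    (v := LinearMap.mul' R A) (fun f => smodEq_apply hτ (LinearMap.lcomp R A f))
    (fun f => smodEq_apply map_smodEq (LinearMap.compRight R f)) rfl
    (TensorProduct.ext' fun a b => by simpa using hττ a b)
  simpa using LinearMap.congr_fun this (a ⊗ₜ b)

theorem existsUnique_algEquiv_sq_eq [Invertible (2 : R)] [IsAdicComplete (Ideal.span {ℓ}) A]
    (hℓ : IsSMulRegular A ℓ) {σ : A ≃ₐ[R] A}
    (hσ : ∀ a, σ a ≡ a [SMOD (Ideal.span {ℓ} • ⊤ : Submodule R A)]) :
    ∃! τ : A ≃ₐ[R] A,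
      (∀ a, τ a ≡ a [SMOD (Ideal.span {ℓ} • ⊤ : Submodule R A)]) ∧ τ * τ = σ := by
  obtain ⟨τ, ⟨hτ, hττ⟩, unique⟩ := existsUnique_sq_eq (a := (σ.toLinearMap : Module.End R A))
    (linearMap_smodEq_of_forall_apply hℓ (T' := 1) hσ)
  have τ_smodEq (a : A) : τ a ≡ a [SMOD (Ideal.span {ℓ} • ⊤ : Submodule R A)] :=
    smodEq_apply hτ (LinearMap.applyₗ a)
  have sq_apply (a : A) : τ (τ a) = σ a := LinearMap.congr_fun hττ a
  have map_mul := map_mul_of_sq_eq hτ fun a b => by simp only [sq_apply, map_mul]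
  let e : A ≃ₗ[R] A := .ofBijective τ (bijective_of_smodEq_id _ τ_smodEq)
  have map_one : τ 1 = 1 := by
    obtain ⟨b, hb⟩ := e.surjective 1
    calc τ 1 = τ 1 * τ b := by rw [show τ b = 1 from hb, mul_one]
      _ = 1 := by rw [← map_mul, one_mul]; exact hb
  refine ⟨AlgEquiv.ofLinearEquiv e map_one map_mul, ⟨τ_smodEq, AlgEquiv.ext sq_apply⟩, ?_⟩
  rintro τ' ⟨hτ', hττ'⟩
  have := unique τ'.toLinearMap ⟨linearMap_smodEq_of_forall_apply hℓ (T' := 1) hτ',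
    LinearMap.ext fun a => AlgEquiv.congr_fun hττ' a⟩
  exact AlgEquiv.ext fun a => LinearMap.congr_fun this a

end Algebra

end Principal

section StarAlgebra

variable {R A A' : Type*} [CommRing R] [StarRing R] [Ring A] [StarRing A] [Algebra R A]
  [StarModule R A] [Ring A'] [StarRing A'] [Algebra R A'] [StarModule R A']

/-- The conjugate `a ↦ (φ a⋆)⋆` of an isomorphism of algebras: `φ` preserves the involutions if and
only if it equals its conjugate. -/
def starConj (φ : A ≃ₐ[R] A') : A ≃ₐ[R] A' where
  toFun a := star (φ (star a))
  invFun a' := star (φ.symm (star a'))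
  left_inv a := by simp
  right_inv a' := by simp
  map_mul' a b := by simp
  map_add' a b := by simp
  commutes' r := by simp [← algebraMap_star_comm]

variable {ℓ : R}

theorem starConj_smodEq (star_ℓ : star ℓ = ℓ) {τ : A ≃ₐ[R] A}
    (hτ : ∀ a, τ a ≡ a [SMOD (Ideal.span {ℓ} • ⊤ : Submodule R A)]) (a : A) :
    starConj τ a ≡ a [SMOD (Ideal.span {ℓ} • ⊤ : Submodule R A)] := by
  obtain ⟨z, hz⟩ := smodEq_span_singleton_iff.1 (hτ (star a))
  exact smodEq_span_singleton_iff.2 ⟨star z, by simp [starConj, hz, star_ℓ]⟩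

variable [Invertible (2 : R)] [IsAdicComplete (Ideal.span {ℓ}) A]

theorem exists_sq_eq_and_starConj_eq_inv (hℓ : IsSMulRegular A ℓ) (star_ℓ : star ℓ = ℓ)
    {σ : A ≃ₐ[R] A} (hσ : ∀ a, σ a ≡ a [SMOD (Ideal.span {ℓ} • ⊤ : Submodule R A)])
    (starConj_σ : starConj σ = σ⁻¹) : ∃ τ : A ≃ₐ[R] A, τ * τ = σ ∧ starConj τ = τ⁻¹ := by
  have inv_smodEq {τ : A ≃ₐ[R] A}
      (hτ : ∀ a, τ a ≡ a [SMOD (Ideal.span {ℓ} • ⊤ : Submodule R A)]) (a : A) :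
      τ⁻¹ a ≡ a [SMOD (Ideal.span {ℓ} • ⊤ : Submodule R A)] := by
    have := (hτ (τ⁻¹ a)).symm
    rwa [← AlgEquiv.mul_apply, mul_inv_cancel] at this
  obtain ⟨τ, ⟨hτ, rfl⟩, -⟩ := existsUnique_algEquiv_sq_eq hℓ hσ
  refine ⟨τ, rfl, (existsUnique_algEquiv_sq_eq hℓ (inv_smodEq hσ)).unique
    ⟨starConj_smodEq star_ℓ hτ, ?_⟩ ⟨inv_smodEq hτ, (mul_inv_rev τ τ).symm⟩⟩
  rw [← starConj_σ]
  exact AlgEquiv.ext fun a => by simp [starConj]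

/-- If `τ` is the root of `σ = ρ⁻¹ ∘ starConj ρ`, then
`starConj (ρ ∘ τ) = ρ ∘ σ ∘ τ⁻¹ = ρ ∘ τ`. -/
theorem nonempty_starAlgEquiv_of_smodEq (hℓ : IsSMulRegular A ℓ) (star_ℓ : star ℓ = ℓ)
    (ρ : A ≃ₐ[R] A')
    (hρ : ∀ a, starConj ρ a ≡ ρ a [SMOD (Ideal.span {ℓ} • ⊤ : Submodule R A')]) :
    Nonempty (A ≃⋆ₐ[R] A') := by
  let σ : A ≃ₐ[R] A := (starConj ρ).trans ρ.symm
  obtain ⟨τ, hττ, starConj_τ⟩ := exists_sq_eq_and_starConj_eq_inv hℓ star_ℓ (σ := σ)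
    (fun a => by simpa [σ] using smodEq_apply (hρ a) ρ.symm.toLinearMap)
    (AlgEquiv.ext fun a => (AlgEquiv.eq_symm_apply σ).2 (by simp [σ, starConj]))
  have starConj_eq (a : A) : starConj (τ.trans ρ) a = ρ (τ a) := calc
    _ = starConj ρ (starConj τ a) := by simp [starConj]
    _ = ρ (σ (τ⁻¹ a)) := by simp [σ, starConj_τ]
    _ = ρ (τ a) := by simp [← hττ]
  exact ⟨StarAlgEquiv.ofAlgEquiv (τ.trans ρ) fun a => by
    simpa [starConj] using (starConj_eq (star a)).symm⟩

end StarAlgebra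

end AdicComplete

/-! ## Algebras of functions -/

section HasEnoughStarCharacters

/-- A commutative `*`-algebra over `ℂ` whose characters into `ℂ` separate the points and detect the
units. It plays the role of an algebra of functions, evaluated at points by its characters. -/
class HasEnoughStarCharacters (C : Type*) [CommRing C] [StarRing C] [Algebra ℂ C] : Prop where
  eq_zero : ∀ f : C, (∀ χ : C →⋆ₐ[ℂ] ℂ, χ f = 0) → f = 0
  isUnit : ∀ f : C, (∀ χ : C →⋆ₐ[ℂ] ℂ, χ f ≠ 0) → IsUnit f

namespace HasEnoughStarCharacters

variable {C D : Type*} [CommRing C] [StarRing C] [Algebra ℂ C] [HasEnoughStarCharacters C]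
  [CommRing D] [StarRing D] [Algebra ℂ D] [HasEnoughStarCharacters D]

variable (C) in
theorem isReduced : IsReduced C where
  eq_zero f := fun ⟨k, hk⟩ => eq_zero f fun χ =>
    eq_zero_of_pow_eq_zero (n := k) (by rw [← map_pow, hk, map_zero])

open scoped ComplexOrder in
theorem isUnit_one_add_mul_conjTranspose {ι : Type*} [Fintype ι] [DecidableEq ι]
    (a : Matrix ι ι C) : IsUnit (1 + a * a.conjTranspose) := by
  rw [Matrix.isUnit_iff_isUnit_det]
  refine isUnit _ fun χ => ?_
  have map_eq : (1 + a * a.conjTranspose).map χ = 1 + a.map χ * (a.map χ).conjTranspose := by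
    rw [← Matrix.conjTranspose_map χ fun c => map_star χ c, ← Matrix.map_mul,
      Matrix.map_add χ (map_add χ), Matrix.map_one χ (map_zero χ) (map_one χ)]
  have posDef := Matrix.PosDef.one.add_posSemidef
    (Matrix.posSemidef_self_mul_conjTranspose (a.map χ))
  rw [← map_eq] at posDef
  exact (RingHom.map_det (χ : C →+* ℂ) _).trans_ne posDef.det_pos.ne'

/-- If `ψ` differed from every `*`-character at `c` or at `star c`, the element `h` of its kernel
would be invertible. -/
theorem algHom_complex_map_star (ψ : C →ₐ[ℂ] ℂ) (c : C) : ψ (star c) = star (ψ c) := by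
  let a := c - algebraMap ℂ C (ψ c)
  let b := star c - algebraMap ℂ C (ψ (star c))
  let h := star a * a + star b * b
  have ψ_h : ψ h = 0 := by simp [h, a, b]
  obtain ⟨χ, hχ⟩ : ∃ χ : C →⋆ₐ[ℂ] ℂ, χ h = 0 := by
    by_contra! hχ
    exact ((isUnit h hχ).map ψ).ne_zero ψ_h
  have sum_normSq : Complex.normSq (χ a) + Complex.normSq (χ b) = 0 := by
    simpa only [h, map_add, map_mul, map_star, Complex.star_def, ← Complex.normSq_eq_conj_mul_self,
      ← Complex.ofReal_add, Complex.ofReal_eq_zero] using hχ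
  have χ_a : χ a = 0 := Complex.normSq_eq_zero.1
    (by linarith [Complex.normSq_nonneg (χ a), Complex.normSq_nonneg (χ b)])
  have χ_b : χ b = 0 := Complex.normSq_eq_zero.1
    (by linarith [Complex.normSq_nonneg (χ a), Complex.normSq_nonneg (χ b)])
  have χ_c : χ c = ψ c := by
    simpa only [a, map_sub, sub_eq_zero, AlgHomClass.commutes χ, Algebra.algebraMap_self_apply]
      using χ_a
  have χ_star_c : star (χ c) = ψ (star c) := by
    simpa only [b, map_sub, sub_eq_zero, AlgHomClass.commutes χ, Algebra.algebraMap_self_apply,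
      map_star] using χ_b
  rw [← χ_star_c, χ_c]

theorem algHom_map_star (φ : C →ₐ[ℂ] D) (c : C) : φ (star c) = star (φ c) := by
  refine sub_eq_zero.1 (eq_zero _ fun χ => ?_)
  have := algHom_complex_map_star ((χ : D →ₐ[ℂ] ℂ).comp φ) c
  simpa [sub_eq_zero, map_star] using this

end HasEnoughStarCharacters

namespace SmoothFun

variable {n : ℕ} {M : Type u} [TopologicalSpace M] [ChartedSpace (EuclideanSpace ℝ (Fin n)) M]

/-- Evaluation at a point, as a `*`-character. -/
noncomputable def eval (x : M) : SmoothFun n M →⋆ₐ[ℂ] ℂ where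
  toFun f := f x
  map_one' := rfl
  map_mul' _ _ := rfl
  map_zero' := rfl
  map_add' _ _ := rfl
  commutes' _ := rfl
  map_star' f := star_apply f x

instance instHasEnoughStarCharacters : HasEnoughStarCharacters (SmoothFun n M) where
  eq_zero _ hf := ContMDiffMap.ext fun x => hf (eval x)
  isUnit f hf := by
    have contMDiff_inv : ContMDiff (𝓡 n) 𝓘(ℝ, ℂ) ∞ fun x => (f x)⁻¹ := fun x =>
      (contDiffAt_inv ℝ (hf (eval x))).contMDiffAt.comp x (f.contMDiff x)
    exact .of_mul_eq_one ⟨fun x => (f x)⁻¹, contMDiff_inv⟩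
      (ContMDiffMap.ext fun x => mul_inv_cancel₀ (hf (eval x)))

end SmoothFun

end HasEnoughStarCharacters

/-! ## Formal deformations -/

section FormalDeformation

/-- The `*`-algebra `B` over `ℂ⟦X⟧` is a formal deformation of the commutative `*`-algebra `C`, its
classical limit: `cl` is the reduction modulo the formal parameter `X`, and `B` is complete and
torsion free with respect to `X`. -/
structure IsFormalDeformation {B C : Type*} [Ring B] [StarRing B] [Algebra ℂ⟦X⟧ B] [CommRing C]
    [StarRing C] [Algebra ℂ C] (cl : B →+* C) : Prop where
  isAdicComplete : IsAdicComplete (Ideal.span {(PowerSeries.X : ℂ⟦X⟧)}) B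
  isSMulRegular : IsSMulRegular B (PowerSeries.X : ℂ⟦X⟧)
  surjective : Function.Surjective cl
  map_smul : ∀ (c : ℂ⟦X⟧) (b : B), cl (c • b) = PowerSeries.constantCoeff c • cl b
  exists_eq_smul : ∀ b, cl b = 0 → ∃ b', b = (PowerSeries.X : ℂ⟦X⟧) • b'
  map_star : ∀ b, cl (star b) = star (cl b)

namespace IsFormalDeformation

variable {B C D : Type*} [Ring B] [StarRing B] [Algebra ℂ⟦X⟧ B] [CommRing C] [StarRing C]
  [Algebra ℂ C] [CommRing D] [StarRing D] [Algebra ℂ D] {cl : B →+* C}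

theorem smodEq_iff (h : IsFormalDeformation cl) {b b' : B} :
    b ≡ b' [SMOD (Ideal.span {(PowerSeries.X : ℂ⟦X⟧)} • ⊤ : Submodule ℂ⟦X⟧ B)] ↔ cl b = cl b' := by
  rw [smodEq_span_singleton_iff]
  constructor
  · rintro ⟨z, rfl⟩
    simp [h.map_smul]
  · intro hb
    obtain ⟨z, hz⟩ := h.exists_eq_smul (b - b') (by rw [map_sub, hb, sub_self])
    exact ⟨z, sub_eq_iff_eq_add'.1 hz⟩

theorem mul_comm_smodEq_of_algEquiv (h : IsFormalDeformation cl) {F : Type*} [Ring F]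
    [Algebra ℂ⟦X⟧ F] (φ : B ≃ₐ[ℂ⟦X⟧] Fᵐᵒᵖ) (S T : F) : S * T ≡ T * S
      [SMOD (Ideal.span {(PowerSeries.X : ℂ⟦X⟧)} • ⊤ : Submodule ℂ⟦X⟧ F)] := by
  have := smodEq_apply (h.smodEq_iff.2 (by rw [map_mul, map_mul, mul_comm]))
    ((MulOpposite.opLinearEquiv ℂ⟦X⟧).symm.toLinearMap ∘ₗ φ.toLinearMap)
    (x := φ.symm (op T) * φ.symm (op S)) (y := φ.symm (op S) * φ.symm (op T))
  simpa using this

theorem isUnit_matrix_of_isUnit_map (h : IsFormalDeformation cl) {ι : Type*} [Fintype ι]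
    [DecidableEq ι] {a : Matrix ι ι B} (ha : IsUnit (cl.mapMatrix a)) : IsUnit a := by
  have := h.isAdicComplete
  have : IsAdicComplete (Ideal.span {(PowerSeries.X : ℂ⟦X⟧)}) (Matrix ι ι B) :=
    inferInstanceAs (IsAdicComplete _ (ι → ι → B))
  have smodEq_one {m : Matrix ι ι B} (hm : cl.mapMatrix m = 1) :
      m ≡ 1 [SMOD (Ideal.span {(PowerSeries.X : ℂ⟦X⟧)} • ⊤ : Submodule ℂ⟦X⟧ (Matrix ι ι B))] := by
    rw [← map_one cl.mapMatrix] at hm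
    choose z hz using fun i j => smodEq_span_singleton_iff.1 (h.smodEq_iff.2 congr($hm i j))
    exact smodEq_span_singleton_iff.2 ⟨z, Matrix.ext hz⟩
  choose lift hlift using h.surjective
  let b : Matrix ι ι B := (↑ha.unit⁻¹ : Matrix ι ι C).map lift
  have map_b : cl.mapMatrix b = ↑ha.unit⁻¹ := Matrix.ext fun i j => hlift _
  exact isUnit_of_mul_smodEq_one _ (b := b) (smodEq_one (by rw [map_mul, map_b, ha.mul_val_inv]))
    (smodEq_one (by rw [map_mul, map_b, ha.val_inv_mul]))

theorem isUnit_one_add_mul_conjTranspose [HasEnoughStarCharacters C] (h : IsFormalDeformation cl)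
    {ι : Type*} [Fintype ι] [DecidableEq ι] (a : Matrix ι ι B) :
    IsUnit (1 + a * a.conjTranspose) := by
  refine h.isUnit_matrix_of_isUnit_map ?_
  have map_eq : cl.mapMatrix (1 + a * a.conjTranspose) =
      1 + cl.mapMatrix a * (cl.mapMatrix a).conjTranspose := by
    rw [map_add, map_mul, map_one]
    exact congrArg (1 + _ * ·) (Matrix.conjTranspose_map cl h.map_star)
  exact map_eq ▸ HasEnoughStarCharacters.isUnit_one_add_mul_conjTranspose _

/-- `κ` factors through the classical limit. -/
theorem ringHom_map_star [HasEnoughStarCharacters C] [HasEnoughStarCharacters D]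
    (h : IsFormalDeformation cl) (κ : B →+* D)
    (hκ : ∀ (c : ℂ⟦X⟧) (b : B), κ (c • b) = PowerSeries.constantCoeff c • κ b) (b : B) :
    κ (star b) = star (κ b) := by
  have ker_le : RingHom.ker cl ≤ RingHom.ker κ := fun b hb => by
    obtain ⟨b', rfl⟩ := h.exists_eq_smul b hb
    simp [hκ]
  let κ₀ : C →+* D := cl.liftOfSurjective h.surjective ⟨κ, ker_le⟩
  have κ₀_cl (b : B) : κ₀ (cl b) = κ b := cl.liftOfRightInverse_comp_apply _ _ _ b
  let φ : C →ₐ[ℂ] D := { κ₀ with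
    commutes' := fun c => by
      have := κ₀_cl (PowerSeries.C c • 1)
      simpa [h.map_smul, hκ, Algebra.algebraMap_eq_smul_one] using this }
  rw [← κ₀_cl, ← κ₀_cl, h.map_star]
  exact HasEnoughStarCharacters.algHom_map_star φ (cl b)

end IsFormalDeformation

end FormalDeformation

/-! ## Hermitian forms with a self-dual frame -/

section HermitianDualBasis

/-- With Kaplansky's element `h = 1 + (q - star q) * star (q - star q)`, which commutes with `q`
and `star q`, the projection is `q * star q * h⁻¹`. -/
theorem exists_isSelfAdjoint_of_isIdempotentElem {R : Type*} [Ring R] [StarRing R] {q : R}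
    (hq : IsIdempotentElem q) (hu : IsUnit (1 + (q - star q) * star (q - star q))) :
    ∃ p, IsSelfAdjoint p ∧ p * q = q ∧ q * p = p := by
  obtain ⟨h, h_eq⟩ := hu
  have isSelfAdjoint_h : IsSelfAdjoint h := Units.ext <| by
    rw [Units.coe_star, h_eq, star_add, star_one, star_mul, star_star]
  have h_eq' : (h : R) = 1 + (q * star q - q - (star q - star q * q)) := by
    rw [h_eq, star_sub, star_star, sub_mul, mul_sub, mul_sub, hq.eq, ← star_mul, hq.eq]
  have mul_h : q * h = q * star q * q := by
    simp only [h_eq', mul_add, mul_sub, mul_one, ← mul_assoc, hq.eq]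
    abel
  have commute_h : Commute q h := mul_h.trans <| by
    simp only [h_eq', add_mul, sub_mul, one_mul, mul_assoc, hq.eq]
    abel
  have commute_star : Commute (star q) ↑h⁻¹ := by
    rw [Commute.units_inv_right_iff]
    simpa [← Units.coe_star, isSelfAdjoint_h.star_eq] using commute_h.star_star
  have isSelfAdjoint_inv : IsSelfAdjoint (↑h⁻¹ : R) := by
    rw [IsSelfAdjoint, ← Units.coe_star, star_inv, isSelfAdjoint_h.star_eq]
  refine ⟨q * star q * ↑h⁻¹, ?_, ?_, by simp only [← mul_assoc, hq.eq]⟩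
  · exact ((IsSelfAdjoint.mul_star_self q).commute_iff isSelfAdjoint_inv).1
      (commute_h.units_inv_right.mul_left commute_star)
  · rw [mul_assoc, ← commute_h.units_inv_right.eq, ← mul_assoc, ← mul_h, h.mul_inv_cancel_right]

/-- A `B`-valued Hermitian form on a module, `B`-linear in its second argument, together with a
finite family of vectors which is a dual basis for the form. -/
structure HermitianDualBasis (ι B E : Type*) [Fintype ι] [Ring B] [StarRing B] [AddCommGroup E]
    [Module B E] where
  form : E → E →ₗ[B] B
  star_form : ∀ x y, star (form y x) = form x y
  vec : ι → E
  sum_form_smul_vec : ∀ x, ∑ k, form (vec k) x • vec k = x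

namespace HermitianDualBasis

variable {ι B E : Type*} [Fintype ι] [Ring B] [StarRing B] [AddCommGroup E] [Module B E]

open Matrix in
/-- A dual basis embeds `E` into `ι → B` as the range of the idempotent matrix `φ j (y i)`, and the
standard Hermitian form, twisted by the projection onto this range, restricts to the form. -/
theorem nonempty_of_dual_basis [DecidableEq ι]
    (hB : ∀ a : Matrix ι ι B, IsUnit (1 + a * aᴴ))
    (φ : ι → E →ₗ[B] B) (y : ι → E) (hφ : ∀ x, ∑ i, φ i x • y i = x) :
    Nonempty (HermitianDualBasis ι B E) := by
  let coord : E →ₗ[B] ι → B := LinearMap.pi φ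
  let q : Matrix ι ι B := .of fun i => coord (y i)
  have coord_sum (b : ι → B) : coord (∑ k, b k • y k) = b ᵥ* q := by
    ext j
    simp [vecMul, dotProduct, q]
  have coord_vecMul (x : E) : coord x ᵥ* q = coord x := by
    rw [← coord_sum (coord x)]
    exact congrArg coord (hφ x)
  have isIdempotentElem_q : IsIdempotentElem q := funext fun i => coord_vecMul (y i)
  obtain ⟨p, star_p, p_mul, mul_p⟩ :=
    exists_isSelfAdjoint_of_isIdempotentElem isIdempotentElem_q (hB _)
  have conjTranspose_p : pᴴ = p := star_p
  have p_mul_conjTranspose : p * qᴴ = p := by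
    simpa [conjTranspose_p] using congrArg conjTranspose mul_p
  let form (w : E) : E →ₗ[B] B :=
    { toFun := fun x => coord x ᵥ* p ⬝ᵥ star (coord w)
      map_add' := fun x x' => by rw [map_add, add_vecMul, add_dotProduct]
      map_smul' := fun b x => by rw [map_smul, smul_vecMul, smul_dotProduct, RingHom.id_apply] }
  have form_vec (x : E) : (fun k => form (y k) x) = coord x ᵥ* p := by
    conv_rhs => rw [← p_mul_conjTranspose, ← vecMul_vecMul]
    rfl
  refine ⟨⟨form, fun x w => ?_, y, fun x => ?_⟩⟩
  · change star (coord x ᵥ* p ⬝ᵥ star (coord w)) = coord w ᵥ* p ⬝ᵥ star (coord x)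
    rw [← star_dotProduct_star, star_star, star_vecMul, conjTranspose_p, dotProduct_mulVec]
  · have coord_eq : coord (∑ k, form (y k) x • y k) = coord x := by
      rw [coord_sum, form_vec, vecMul_vecMul, p_mul, coord_vecMul]
    rw [← hφ (∑ k, form (y k) x • y k)]
    exact (Finset.sum_congr rfl fun i _ => congrArg (· • y i) (congrFun coord_eq i)).trans (hφ x)

variable (H : HermitianDualBasis ι B E)

theorem form_add_left (y y' x : E) : H.form (y + y') x = H.form y x + H.form y' x := by
  rw [← H.star_form, map_add, star_add, H.star_form, H.star_form]

theorem form_smul_left (b : B) (y x : E) : H.form (b • y) x = H.form y x * star b := by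
  rw [← H.star_form, map_smul, smul_eq_mul, star_mul, H.star_form]

theorem form_sum_left {κ : Type*} (s : Finset κ) (y : κ → E) (x : E) :
    H.form (∑ i ∈ s, y i) x = ∑ i ∈ s, H.form (y i) x := by
  rw [← H.star_form, map_sum, star_sum]
  simp only [H.star_form]

theorem ext_form {y y' : E} (h : ∀ x, H.form x y = H.form x y') : y = y' := by
  rw [← H.sum_form_smul_vec y, ← H.sum_form_smul_vec y']
  simp only [h]

theorem exists_form_eq (g : E →ₗ[B] B) : ∃ v, H.form v = g := by
  refine ⟨∑ k, star (g (H.vec k)) • H.vec k, LinearMap.ext fun x => ?_⟩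
  conv_rhs => rw [← H.sum_form_smul_vec x]
  simp only [map_sum, map_smul, form_sum_left, form_smul_left, star_star, smul_eq_mul]

/-- The adjoint of an endomorphism with respect to the Hermitian form. -/
def adj (T : Module.End B E) : Module.End B E :=
  ∑ k, (H.form (T (H.vec k))).smulRight (H.vec k)

theorem form_adj_left (T : Module.End B E) (y x : E) :
    H.form (H.adj T y) x = H.form y (T x) := by
  simp only [adj, LinearMap.sum_apply, LinearMap.smulRight_apply, form_sum_left, form_smul_left,
    H.star_form]
  conv_rhs => rw [← H.sum_form_smul_vec x]
  simp

theorem form_adj_right (T : Module.End B E) (y x : E) :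
    H.form y (H.adj T x) = H.form (T y) x := by
  rw [← H.star_form, form_adj_left, H.star_form]

theorem adj_eq_of_forall_form {T T' : Module.End B E}
    (h : ∀ x y, H.form (T y) x = H.form y (T' x)) : H.adj T = T' :=
  LinearMap.ext fun x => H.ext_form fun y => by rw [form_adj_right, h]

/-- The involution of the algebra of endomorphisms given by the adjoint. -/
abbrev adjStarRing : StarRing (Module.End B E) where
  star := H.adj
  star_involutive T := H.adj_eq_of_forall_form fun x y => by rw [form_adj_left]
  star_mul S T := H.adj_eq_of_forall_form fun x y => by
    simp only [Module.End.mul_apply, form_adj_right]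
  star_add S T := H.adj_eq_of_forall_form fun x y => by
    simp only [LinearMap.add_apply, map_add, form_add_left, form_adj_right]

/-- The endomorphism `|z⟩⟨y|` attached to two vectors. -/
def rankOne (y z : E) : Module.End B E := (H.form y).smulRight z

theorem rankOne_apply (y z x : E) : H.rankOne y z x = H.form y x • z := rfl

theorem mul_rankOne (T : Module.End B E) (y z : E) : T * H.rankOne y z = H.rankOne y (T z) :=
  LinearMap.ext fun x => map_smul T (H.form y x) z

theorem adj_rankOne (y z : E) : H.adj (H.rankOne y z) = H.rankOne z y :=
  H.adj_eq_of_forall_form fun x u => by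
    rw [rankOne_apply, rankOne_apply, form_smul_left, H.star_form, map_smul, smul_eq_mul]

theorem rankOne_smul_left (b : B) (y z : E) :
    H.rankOne (b • y) z = H.rankOne y (star b • z) :=
  LinearMap.ext fun x => by rw [rankOne_apply, rankOne_apply, form_smul_left, mul_smul]

theorem sum_rankOne_vec : ∑ k, H.rankOne (H.vec k) (H.vec k) = 1 :=
  LinearMap.ext fun x => by
    simp only [LinearMap.sum_apply, rankOne_apply, H.sum_form_smul_vec, Module.End.one_apply]

section Sesquilinear

variable (𝕂 : Type*) [CommRing 𝕂] [StarRing 𝕂] [Algebra 𝕂 B] [StarModule 𝕂 B] [Module 𝕂 E]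
  [IsScalarTower 𝕂 B E]

theorem form_smul_left_of_tower (c : 𝕂) (y x : E) : H.form (c • y) x = star c • H.form y x := by
  rw [← H.star_form, LinearMap.map_smul_of_tower, star_smul, H.star_form]

theorem adj_smul (c : 𝕂) (T : Module.End B E) : H.adj (c • T) = star c • H.adj T :=
  H.adj_eq_of_forall_form fun x y => by
    simp only [LinearMap.smul_apply, LinearMap.map_smul_of_tower, form_smul_left_of_tower,
      form_adj_right]

/-- `HermitianDualBasis.form` as a sesquilinear map over a base ring. -/
def formₛₗ : E →ₗ⋆[𝕂] E →ₗ[𝕂] B :=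
  LinearMap.mk₂'ₛₗ (starRingEnd 𝕂) (RingHom.id 𝕂) (fun y x => H.form y x)
    H.form_add_left (H.form_smul_left_of_tower 𝕂) (fun y => map_add (H.form y))
    fun c y x => LinearMap.map_smul_of_tower (H.form y) c x

/-- `HermitianDualBasis.rankOne` as a sesquilinear map over a base ring. -/
def rankOneₛₗ : E →ₗ⋆[𝕂] E →ₗ[𝕂] Module.End B E :=
  LinearMap.mk₂'ₛₗ (starRingEnd 𝕂) (RingHom.id 𝕂) H.rankOne
    (fun y y' z => LinearMap.ext fun x => by
      simp only [LinearMap.add_apply, rankOne_apply, form_add_left, add_smul])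
    (fun c y z => LinearMap.ext fun x => by
      simp only [LinearMap.smul_apply, rankOne_apply, form_smul_left_of_tower, smul_assoc,
        starRingEnd_apply])
    (fun y z z' => LinearMap.ext fun x => smul_add (H.form y x) z z')
    fun c y z => LinearMap.ext fun x => smul_comm (H.form y x) c z

end Sesquilinear

section ClassicalLimit

/-! The hypothesis `∑ j, form (v j) (w j) = 1` says that the form is full: its values generate `B`
as a two-sided ideal. -/

variable {D : Type*} [CommRing D] {cl : B →+* D} {m : Type*} [Fintype m] {v w : m → E}

theorem eq_of_forall_mul_cl_form_eq (hvw : ∑ j, H.form (v j) (w j) = 1) {f g : D}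
    (h : ∀ x y, f * cl (H.form y x) = g * cl (H.form y x)) : f = g := by
  rw [← mul_one f, ← mul_one g, ← map_one cl, ← hvw, map_sum, Finset.mul_sum, Finset.mul_sum]
  simp only [h]

variable {κ : Module.End B E →+* D} (hκ : ∀ T x y, cl (H.form y (T x)) = κ T * cl (H.form y x))

include hκ in
/-- The classical limit of `E` has rank one, so that the `2 × 2` minors of the form vanish. -/
theorem cl_form_mul_cl_form_comm [IsReduced D] (x y z u : E) :
    cl (H.form y x) * cl (H.form u z) = cl (H.form y z) * cl (H.form u x) := by
  have cl_form_mul (x y z u : E) : cl (H.form y x) * cl (H.form u z) =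
      κ (H.rankOne y z) * cl (H.form u x) := by
    rw [← hκ, rankOne_apply, map_smul, smul_eq_mul, map_mul]
  refine sub_eq_zero.1 (IsReduced.eq_zero _ ⟨2, ?_⟩)
  linear_combination
    cl (H.form y x) * cl (H.form u z) * cl_form_mul x y z u +
    cl (H.form y z) * cl (H.form u x) * cl_form_mul z y x u -
    cl (H.form u z) * cl (H.form u x) * (cl_form_mul x y z y + cl_form_mul z y x y)

include hκ in
theorem cl_sum_form_vec [IsReduced D] (hvw : ∑ j, H.form (v j) (w j) = 1) :
    cl (∑ k, H.form (H.vec k) (H.vec k)) = 1 := by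
  have map_rankOne (y z : E) : κ (H.rankOne y z) = cl (H.form y z) :=
    H.eq_of_forall_mul_cl_form_eq hvw fun x u => by
      rw [← hκ, rankOne_apply, map_smul, smul_eq_mul, map_mul, H.cl_form_mul_cl_form_comm hκ]
  rw [map_sum, ← map_one κ, ← H.sum_rankOne_vec, map_sum]
  simp only [map_rankOne]

variable [Algebra ℂ⟦X⟧ B] [StarRing D] [Algebra ℂ D] (hcl : IsFormalDeformation cl)

include hκ hcl in
theorem map_adj_of_cl_form (hvw : ∑ j, H.form (v j) (w j) = 1) (T : Module.End B E) :
    κ (H.adj T) = star (κ T) :=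
  H.eq_of_forall_mul_cl_form_eq hvw fun x y => by
    rw [← hκ, form_adj_right, ← H.star_form, hcl.map_star, hκ, star_mul', ← hcl.map_star,
      H.star_form]

variable [Module ℂ⟦X⟧ E] [IsScalarTower ℂ⟦X⟧ B E]

include hcl in
/-- If `End E` is commutative modulo `X`, its elements act on `E` modulo `X` by scalars: they
commute with the operators `rankOne (v j) x`, and `x = ∑ j, rankOne (v j) x (w j)`. -/
theorem exists_ringHom_of_mul_comm_smodEq (hvw : ∑ j, H.form (v j) (w j) = 1)
    (hcomm : ∀ S T : Module.End B E, S * T ≡ T * S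
      [SMOD (Ideal.span {(PowerSeries.X : ℂ⟦X⟧)} • ⊤ : Submodule ℂ⟦X⟧ (Module.End B E))]) :
    ∃ κ : Module.End B E →+* D, ∀ T x y, cl (H.form y (T x)) = κ T * cl (H.form y x) := by
  let scalar (T : Module.End B E) : B := ∑ j, H.form (v j) (T (w j))
  have apply_smodEq (T : Module.End B E) (x : E) : T x ≡ scalar T • x
      [SMOD (Ideal.span {(PowerSeries.X : ℂ⟦X⟧)} • ⊤ : Submodule ℂ⟦X⟧ E)] := by
    have := SModEq.sum (s := Finset.univ) fun j _ =>
      smodEq_apply (hcomm T (H.rankOne (v j) x)) (LinearMap.applyₗ' ℂ⟦X⟧ (w j))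
    simpa [rankOne_apply, ← Finset.sum_smul, hvw] using this
  have cl_form_apply (T : Module.End B E) (x y : E) :
      cl (H.form y (T x)) = cl (scalar T) * cl (H.form y x) := by
    rw [← map_mul, ← smul_eq_mul, ← map_smul, ← hcl.smodEq_iff]
    exact smodEq_apply (apply_smodEq T x) ((H.form y).restrictScalars ℂ⟦X⟧)
  exact ⟨{
    toFun := fun T => cl (scalar T)
    map_one' := by simp [scalar, hvw]
    map_mul' := fun S T => by
      calc cl (∑ j, H.form (v j) (S (T (w j))))
          = ∑ j, cl (scalar S) * cl (H.form (v j) (T (w j))) := by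
            rw [map_sum]
            exact Finset.sum_congr rfl fun j _ => cl_form_apply S (T (w j)) (v j)
        _ = cl (scalar S) * cl (scalar T) := by rw [← Finset.mul_sum, ← map_sum]
    map_zero' := by simp [scalar]
    map_add' := fun S T => by simp [scalar, Finset.sum_add_distrib] }, cl_form_apply⟩

include hκ hcl in
theorem map_smul_of_cl_form (hvw : ∑ j, H.form (v j) (w j) = 1) (c : ℂ⟦X⟧)
    (T : Module.End B E) : κ (c • T) = PowerSeries.constantCoeff c • κ T :=
  H.eq_of_forall_mul_cl_form_eq hvw fun x y => by
    rw [← hκ, LinearMap.smul_apply, LinearMap.map_smul_of_tower, hcl.map_smul, hκ,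
      smul_mul_assoc]

include hκ hcl in
theorem smodEq_of_map_eq [StarModule ℂ⟦X⟧ B] {S T : Module.End B E} (h : κ S = κ T) :
    S ≡ T [SMOD (Ideal.span {(PowerSeries.X : ℂ⟦X⟧)} • ⊤ : Submodule ℂ⟦X⟧ (Module.End B E))] := by
  have apply_smodEq (x : E) :
      S x ≡ T x [SMOD (Ideal.span {(PowerSeries.X : ℂ⟦X⟧)} • ⊤ : Submodule ℂ⟦X⟧ E)] := by
    rw [← H.sum_form_smul_vec (S x), ← H.sum_form_smul_vec (T x)]
    have cl_form_eq (k : ι) : cl (H.form (H.vec k) (S x)) = cl (H.form (H.vec k) (T x)) := by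
      rw [hκ, hκ, h]
    exact SModEq.sum fun k _ => smodEq_apply (hcl.smodEq_iff.2 (cl_form_eq k))
      ((LinearMap.toSpanSingleton B E (H.vec k)).restrictScalars ℂ⟦X⟧)
  rw [← mul_one S, ← mul_one T, ← H.sum_rankOne_vec, Finset.mul_sum, Finset.mul_sum]
  simp only [mul_rankOne]
  exact SModEq.sum fun k _ => smodEq_apply (apply_smodEq (H.vec k)) (H.rankOneₛₗ ℂ⟦X⟧ (H.vec k))

end ClassicalLimit

end HermitianDualBasis

end HermitianDualBasis

section FormalParameter

theorem star_formalParameter : star (PowerSeries.X : ℂ⟦X⟧) = PowerSeries.X := by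
  ext k
  rw [PowerSeries.coeff_star, PowerSeries.coeff_X]
  split_ifs <;> simp

noncomputable instance invertibleTwoPowerSeries : Invertible (2 : ℂ⟦X⟧) where
  invOf := PowerSeries.C 2⁻¹
  invOf_mul_self := by
    rw [← map_ofNat PowerSeries.C 2, ← map_mul, inv_mul_cancel₀ two_ne_zero, map_one]
  mul_invOf_self := by
    rw [← map_ofNat PowerSeries.C 2, ← map_mul, mul_inv_cancel₀ two_ne_zero, map_one]

theorem IsFormalDeformation.exists_isSelfAdjoint_mul_self_eq {B C : Type*} [Ring B] [StarRing B]
    [Algebra ℂ⟦X⟧ B] [StarModule ℂ⟦X⟧ B] [CommRing C] [StarRing C] [Algebra ℂ C] {cl : B →+* C}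
    (h : IsFormalDeformation cl) {b : B} (star_b : IsSelfAdjoint b) (hb : cl b = 1) :
    ∃ g : Bˣ, IsSelfAdjoint g ∧ (g * g : B) = b := by
  have := h.isAdicComplete
  obtain ⟨g, ⟨hg, g_mul_g⟩, unique⟩ :=
    existsUnique_sq_eq (h.smodEq_iff.2 (hb.trans (map_one cl).symm))
  have star_g : star g = g := by
    refine unique _ ⟨h.smodEq_iff.2 ?_, by rw [← star_mul, g_mul_g, star_b.star_eq]⟩
    rw [h.map_star, h.smodEq_iff.1 hg, map_one, star_one]
  obtain ⟨g, rfl⟩ : IsUnit g := isUnit_of_mul_smodEq_one (Ideal.span {(PowerSeries.X : ℂ⟦X⟧)})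
    (b := 1) (by rwa [mul_one]) (by rwa [one_mul])
  exact ⟨g, Units.ext star_g, g_mul_g⟩

end FormalParameter

namespace HermitianDualBasis

theorem exists_sum_form_eq_one {ι B D E : Type*} [Fintype ι] [Ring B]
    [StarRing B] [Algebra ℂ⟦X⟧ B] [StarModule ℂ⟦X⟧ B] [CommRing D] [StarRing D] [Algebra ℂ D]
    [AddCommGroup E] [Module B E] {cl : B →+* D} (H : HermitianDualBasis ι B E)
    (hcl : IsFormalDeformation cl)
    (h : cl (∑ k, H.form (H.vec k) (H.vec k)) = 1) : ∃ q : ι → E, ∑ k, H.form (q k) (q k) = 1 := by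
  obtain ⟨g, star_g, hg⟩ := hcl.exists_isSelfAdjoint_mul_self_eq
    (by simp only [IsSelfAdjoint, star_sum, H.star_form]) h
  have star_inv : star (↑g⁻¹ : B) = ↑g⁻¹ := by
    rw [← Units.coe_star, star_inv, star_g.star_eq]
  refine ⟨fun k => (↑g⁻¹ : B) • H.vec k, ?_⟩
  simp only [form_smul_left, map_smul, smul_eq_mul, star_inv, ← mul_assoc]
  rw [← Finset.sum_mul, ← Finset.mul_sum, ← hg, ← mul_assoc, g.inv_mul, one_mul, g.mul_inv]

variable {ι A B E C D : Type*} [Fintype ι] [Ring A] [StarRing A] [Algebra ℂ⟦X⟧ A]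
  [StarModule ℂ⟦X⟧ A] [Ring B] [StarRing B] [Algebra ℂ⟦X⟧ B] [StarModule ℂ⟦X⟧ B]
  [AddCommGroup E] [Module ℂ⟦X⟧ E] [Module B E] [IsScalarTower ℂ⟦X⟧ B E] [CommRing C] [StarRing C]
  [Algebra ℂ C] [CommRing D] [StarRing D] [Algebra ℂ D] {clA : A →+* C} {clB : B →+* D}
  (H : HermitianDualBasis ι B E) {m : Type*} [Fintype m] {v w : m → E}

theorem exists_algEquiv_map_star [HasEnoughStarCharacters C] [HasEnoughStarCharacters D]
    (hA : IsFormalDeformation clA) (hB : IsFormalDeformation clB)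
    (hvw : ∑ j, H.form (v j) (w j) = 1) {κ : Module.End B E →+* D}
    (hκ : ∀ T x y, clB (H.form y (T x)) = κ T * clB (H.form y x))
    (φ : A ≃ₐ[ℂ⟦X⟧] (Module.End B E)ᵐᵒᵖ) :
    ∃ ψ : A ≃ₐ[ℂ⟦X⟧] (Module.End B E)ᵐᵒᵖ, ∀ a, ψ (star a) = op (H.adj (ψ a).unop) := by
  let _ := H.adjStarRing
  have : StarModule ℂ⟦X⟧ (Module.End B E) := ⟨H.adj_smul ℂ⟦X⟧⟩
  have := hA.isAdicComplete
  let κA : A →+* D := (κ.fromOpposite fun _ _ => mul_comm _ _).comp φ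
  have κ_star (a : A) : κ (φ (star a)).unop = star (κ (φ a).unop) :=
    hA.ringHom_map_star κA (fun c a => by
      exact (congrArg (κ ·.unop) (map_smul φ c a)).trans
        (H.map_smul_of_cl_form hκ hB hvw c (φ a).unop)) a
  have map_starConj (a : A) : κ (starConj φ a).unop = κ (φ a).unop := calc
    _ = star (κ (φ (star a)).unop) := H.map_adj_of_cl_form hκ hB hvw _
    _ = κ (φ a).unop := by rw [← κ_star, star_star]
  obtain ⟨ψ⟩ := nonempty_starAlgEquiv_of_smodEq hA.isSMulRegular star_formalParameter φ
    fun a => smodEq_apply (H.smodEq_of_map_eq hκ hB (map_starConj a))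
      (MulOpposite.opLinearEquiv ℂ⟦X⟧).toLinearMap
  exact ⟨ψ.toAlgEquiv, fun a => map_star ψ a⟩

end HermitianDualBasis

/-! ## Positivity -/

section Positivity

theorem RealFormalPos.add {a b : ℝ⟦X⟧} (ha : RealFormalPos a) (hb : RealFormalPos b) :
    RealFormalPos (a + b) := by
  obtain ⟨k, coeff_a, pos_a⟩ := ha
  obtain ⟨l, coeff_b, pos_b⟩ := hb
  refine ⟨min k l, fun j hj => ?_, ?_⟩
  · rw [map_add, coeff_a j (by omega), coeff_b j (by omega), add_zero]
  · rw [map_add]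
    rcases lt_trichotomy k l with h | rfl | h
    · rwa [min_eq_left h.le, coeff_b k h, add_zero]
    · rw [min_self]
      exact add_pos pos_a pos_b
    · rwa [min_eq_right h.le, coeff_a l h, zero_add]

theorem FormalNonneg.add {z w : ℂ⟦X⟧} (hz : FormalNonneg z) (hw : FormalNonneg w) :
    FormalNonneg (z + w) := by
  rcases hz with rfl | ⟨a, ha, rfl⟩
  · rwa [zero_add]
  rcases hw with rfl | ⟨b, hb, rfl⟩
  · rw [add_zero]
    exact Or.inr ⟨a, ha, rfl⟩
  · exact Or.inr ⟨a + b, ha.add hb, (map_add _ _ _).symm⟩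

theorem FormalNonneg.sum {ι : Type*} (s : Finset ι) (z : ι → ℂ⟦X⟧)
    (h : ∀ i ∈ s, FormalNonneg (z i)) : FormalNonneg (∑ i ∈ s, z i) :=
  Finset.sum_induction z FormalNonneg (fun _ _ => FormalNonneg.add) (Or.inl rfl) h

variable {A K : Type u} [Ring A] [Algebra ℂ⟦X⟧ A] [StarRing A] [AddCommGroup K] [Module ℂ⟦X⟧ K]
  {ip : FormalPreHilbert K}

theorem IsPositiveElement.sum_star_mul_self {ι : Type*} (s : Finset ι) (a : ι → A) :
    IsPositiveElement (∑ i ∈ s, star (a i) * a i) := fun τ hτ => by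
  rw [map_sum]
  exact FormalNonneg.sum s _ fun i _ => hτ (a i)

variable (ip) in
theorem FormalPreHilbert.inner_self_nonneg (φ : K) : FormalNonneg (ip.inner φ φ) := by
  by_cases h : φ = 0
  · exact Or.inl (by rw [h, map_zero])
  · exact Or.inr (ip.pos_def φ h)

theorem FormalStarRep.sum_inner_nonneg (π : FormalStarRep A ip) {ι κ : Type*} [Fintype ι]
    [Fintype κ] (a : κ → ι → A) (φ : ι → K) :
    FormalNonneg (∑ i, ∑ j, ip.inner (φ i) (π.toHom (∑ l, star (a l i) * a l j) (φ j))) := by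
  have sum_eq : ∑ i, ∑ j, ip.inner (φ i) (π.toHom (∑ l, star (a l i) * a l j) (φ j)) =
      ∑ l, ip.inner (∑ i, π.toHom (a l i) (φ i)) (∑ j, π.toHom (a l j) (φ j)) := by
    simp only [map_sum, map_mul, LinearMap.sum_apply, Module.End.mul_apply, π.adjoint (star _),
      star_star]
    rw [Finset.sum_comm]
    simp only [Finset.sum_comm (s := (Finset.univ : Finset ι)) (t := (Finset.univ : Finset κ))]
  rw [sum_eq]
  exact FormalNonneg.sum _ _ fun l _ => ip.inner_self_nonneg _

end Positivity

namespace HermitianDualBasis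

section Values

variable {ι E : Type*} [Fintype ι] {B : Type u} [Ring B] [StarRing B] [Algebra ℂ⟦X⟧ B]
  [AddCommGroup E] [Module B E] (H : HermitianDualBasis ι B E)

theorem isPositiveElement_form_self (x : E) : IsPositiveElement (H.form x x) := by
  have form_self_eq : H.form x x = ∑ k, star (H.form x (H.vec k)) * H.form x (H.vec k) := calc
    _ = H.form x (∑ k, H.form (H.vec k) x • H.vec k) := by rw [sum_form_smul_vec]
    _ = _ := by simp only [map_sum, map_smul, smul_eq_mul, H.star_form]
  rw [form_self_eq]
  exact IsPositiveElement.sum_star_mul_self _ _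

theorem span_form_eq_top {m : Type*} [Fintype m] {v w : m → E}
    (hvw : ∑ j, H.form (v j) (w j) = 1) :
    Submodule.span ℂ⟦X⟧ {b : B | ∃ x y, H.form y x = b} = ⊤ := eq_top_iff.2 fun b _ => by
  rw [← mul_one b, ← hvw, Finset.mul_sum]
  exact Submodule.sum_mem _ fun j _ =>
    Submodule.subset_span ⟨b • w j, v j, map_smul (H.form (v j)) b (w j)⟩

end Values

section CoForm

variable {ι A B E : Type*} [Fintype ι] [Ring A] [Algebra ℂ⟦X⟧ A] [Ring B] [StarRing B]
  [Algebra ℂ⟦X⟧ B] [StarModule ℂ⟦X⟧ B] [AddCommGroup E] [Module ℂ⟦X⟧ E] [Module B E]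
  [IsScalarTower ℂ⟦X⟧ B E] (H : HermitianDualBasis ι B E) (φ : A ≃ₐ[ℂ⟦X⟧] (Module.End B E)ᵐᵒᵖ)

/-- The `A`-valued form on `E`, for an algebra `A` identified with the opposite of `End E`, whose
value at `(y, z)` is the operator `|z⟩⟨y|`. -/
noncomputable def coForm : E →ₗ⋆[ℂ⟦X⟧] E →ₗ[ℂ⟦X⟧] A :=
  (H.rankOneₛₗ ℂ⟦X⟧).compr₂ₛₗ (φ.symm.toLinearMap ∘ₗ (MulOpposite.opLinearEquiv ℂ⟦X⟧).toLinearMap)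

theorem map_coForm (y z : E) : φ (H.coForm φ y z) = op (H.rankOne y z) :=
  φ.apply_symm_apply _

theorem coForm_apply_right (y z : E) (a : A) :
    H.coForm φ y ((φ a).unop z) = H.coForm φ y z * a :=
  φ.injective <| by rw [map_mul, map_coForm, map_coForm, ← mul_rankOne, MulOpposite.op_mul,
    MulOpposite.op_unop]

theorem coForm_smul_left_eq (b : B) (y z : E) :
    H.coForm φ (b • y) z = H.coForm φ y (star b • z) :=
  φ.injective <| by rw [map_coForm, map_coForm, rankOne_smul_left]

theorem sum_coForm_vec : ∑ k, H.coForm φ (H.vec k) (H.vec k) = 1 :=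
  φ.injective <| by
    simp only [map_sum, map_coForm, ← Finset.op_sum, sum_rankOne_vec, MulOpposite.op_one, map_one]

theorem span_coForm_eq_top : Submodule.span ℂ⟦X⟧ {a : A | ∃ x y, H.coForm φ x y = a} = ⊤ :=
  eq_top_iff.2 fun a _ => by
    rw [← one_mul a, ← H.sum_coForm_vec φ, Finset.sum_mul]
    exact Submodule.sum_mem _ fun k _ =>
      Submodule.subset_span ⟨_, _, H.coForm_apply_right φ _ _ a⟩

variable [StarRing A] {φ} (hφ : ∀ a, φ (star a) = op (H.adj (φ a).unop))

include hφ in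
theorem star_coForm (y z : E) : star (H.coForm φ z y) = H.coForm φ y z :=
  φ.injective <| by rw [hφ, map_coForm, map_coForm, MulOpposite.unop_op, adj_rankOne]

include hφ in
theorem coForm_eq_sum {κ : Type*} [Fintype κ] {q : κ → E} (hq : ∑ j, H.form (q j) (q j) = 1)
    (y z : E) : H.coForm φ y z = ∑ j, star (H.coForm φ (q j) y) * H.coForm φ (q j) z := by
  have mul_eq (j : κ) : star (H.coForm φ (q j) y) * H.coForm φ (q j) z =
      H.coForm φ y (H.form (q j) (q j) • z) := φ.injective <| by
    rw [H.star_coForm hφ, map_mul, map_coForm, map_coForm, map_coForm, ← MulOpposite.op_mul,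
      mul_rankOne, rankOne_apply]
  simp only [mul_eq]
  rw [← map_sum, ← Finset.sum_smul, hq, one_smul]

end CoForm

variable {ι : Type*} {A B E : Type u} [Fintype ι] [Ring A] [Algebra ℂ⟦X⟧ A] [StarRing A] [Ring B]
  [StarRing B] [Algebra ℂ⟦X⟧ B] [StarModule ℂ⟦X⟧ B] [AddCommGroup E] [Module ℂ⟦X⟧ E] [Module B E]
  [IsScalarTower ℂ⟦X⟧ B E] (H : HermitianDualBasis ι B E)

theorem stronglyMoritaEquivalent {φ : A ≃ₐ[ℂ⟦X⟧] (Module.End B E)ᵐᵒᵖ}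
    (hφ : ∀ a, φ (star a) = op (H.adj (φ a).unop)) {κ : Type*} [Fintype κ] {q : κ → E}
    (hq : ∑ j, H.form (q j) (q j) = 1) : StronglyMoritaEquivalent A B := by
  let _ : Module Aᵐᵒᵖ E :=
    Module.compHom E (AlgEquiv.opComm φ : Aᵐᵒᵖ →+* Module.End B E)
  have op_smul (a : A) (x : E) : op a • x = (φ a).unop x := rfl
  have : IsScalarTower ℂ⟦X⟧ Aᵐᵒᵖ E := ⟨fun c a x =>
    LinearMap.congr_fun (map_smul (AlgEquiv.opComm φ) c a) x⟩
  have : SMulCommClass B Aᵐᵒᵖ E := ⟨fun b a x => (map_smul (φ a.unop).unop b x).symm⟩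
  exact ⟨E, _, _, _, _, ‹_›, ‹_›, ‹_›, ⟨{
    innerA := H.coForm φ
    innerA_conj_symm := fun x y => H.star_coForm hφ x y
    innerA_smul_right := fun x y a => H.coForm_apply_right φ x y a
    innerA_pos := fun x => by
      rw [H.coForm_eq_sum hφ hq]
      exact IsPositiveElement.sum_star_mul_self _ _
    innerA_adjoint := H.coForm_smul_left_eq φ
    innerB := (H.formₛₗ ℂ⟦X⟧).flip
    innerB_conj_symm := fun x y => H.star_form y x
    innerB_smul_left := fun b x y => map_smul (H.form y) b x
    innerB_pos := H.isPositiveElement_form_self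
    innerB_adjoint := fun x y a => by
      change H.form ((φ a).unop y) x = H.form y ((φ (star a)).unop x)
      rw [hφ, MulOpposite.unop_op, form_adj_right]
    compatible := fun x y z => by
      rw [op_smul, map_coForm]
      rfl
    fullA := H.span_coForm_eq_top φ
    fullB := H.span_form_eq_top hq
    tensor_nonneg := fun K _ _ ip π m x ψ => by
      simpa only [← H.coForm_eq_sum hφ hq] using
        π.sum_inner_nonneg (fun j i => H.coForm φ (q j) (x i)) ψ }⟩⟩

end HermitianDualBasis

/-! ## Progenerators -/

section Morita

open CategoryTheory
open scoped ModuleCat.Algebra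

/-- `X` is a retract of a finite power of `P`. When `P` is the free module of rank one, this says
that `X` is finitely generated projective; when `X` is, it says that `P` is a generator. -/
def IsRetractOfPower {C : Type*} [Category C] [Preadditive C] (P X : C) : Prop :=
  ∃ (n : ℕ) (a : Fin n → (X ⟶ P)) (b : Fin n → (P ⟶ X)), ∑ i, a i ≫ b i = 𝟙 X

namespace IsRetractOfPower

section Preadditive

variable {C D : Type*} [Category C] [Preadditive C] [Category D] [Preadditive D] {P P' X X' : C}

theorem map (h : IsRetractOfPower P X) (F : C ⥤ D) [F.Additive] :
    IsRetractOfPower (F.obj P) (F.obj X) := by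
  obtain ⟨n, a, b, hab⟩ := h
  refine ⟨n, fun i => F.map (a i), fun i => F.map (b i), ?_⟩
  simp only [← F.map_comp, ← F.map_sum, hab, F.map_id]

theorem of_iso (h : IsRetractOfPower P X) (e : P ≅ P') (f : X ≅ X') : IsRetractOfPower P' X' := by
  obtain ⟨n, a, b, hab⟩ := h
  refine ⟨n, fun i => f.inv ≫ a i ≫ e.hom, fun i => e.inv ≫ b i ≫ f.hom, ?_⟩
  calc ∑ i, (f.inv ≫ a i ≫ e.hom) ≫ e.inv ≫ b i ≫ f.hom
      = f.inv ≫ (∑ i, a i ≫ b i) ≫ f.hom := by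
        simp [Preadditive.comp_sum, Preadditive.sum_comp]
    _ = 𝟙 X' := by rw [hab, Category.id_comp, f.inv_hom_id]

theorem isSeparator (h : IsRetractOfPower P X) (hX : IsSeparator X) : IsSeparator P := by
  obtain ⟨n, a, b, hab⟩ := h
  rw [Preadditive.isSeparator_iff] at hX ⊢
  refine fun Y Z f hf => hX f fun x => ?_
  rw [← Category.id_comp x, ← hab]
  simp only [Preadditive.sum_comp, Category.assoc, hf, Limits.comp_zero, Finset.sum_const_zero]

end Preadditive

variable {B : Type u} [Ring B]

theorem iff_exists_dual_basis {E : ModuleCat.{u} B} :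
    IsRetractOfPower (ModuleCat.of B B) E ↔
      ∃ (n : ℕ) (φ : Fin n → E →ₗ[B] B) (y : Fin n → E), ∀ x, ∑ i, φ i x • y i = x := by
  constructor
  · rintro ⟨n, a, b, hab⟩
    refine ⟨n, fun i => (a i).hom, fun i => (b i).hom (1 : B), fun x => ?_⟩
    have := congr($(hab).hom x)
    simpa [ModuleCat.hom_sum, ← map_smul] using this
  · rintro ⟨n, φ, y, h⟩
    refine ⟨n, fun i => ModuleCat.ofHom (φ i),
      fun i => ModuleCat.ofHom (LinearMap.toSpanSingleton B E (y i)), ?_⟩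
    ext x
    simpa [ModuleCat.hom_sum] using h x

theorem iff_exists_sum_eq_one {E : ModuleCat.{u} B} :
    IsRetractOfPower E (ModuleCat.of B B) ↔
      ∃ (n : ℕ) (g : Fin n → E →ₗ[B] B) (w : Fin n → E), ∑ j, g j (w j) = 1 := by
  constructor
  · rintro ⟨n, a, b, hab⟩
    refine ⟨n, fun i => (b i).hom, fun i => (a i).hom (1 : B), ?_⟩
    have := congr($(hab).hom 1)
    simpa [ModuleCat.hom_sum] using this
  · rintro ⟨n, g, w, h⟩
    refine ⟨n, fun i => ModuleCat.ofHom (LinearMap.toSpanSingleton B E (w i)),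
      fun i => ModuleCat.ofHom (g i), ?_⟩
    ext
    simpa [ModuleCat.hom_sum] using h

theorem of_isSeparator {V : ModuleCat.{u} B} (hV : IsSeparator V) :
    IsRetractOfPower V (ModuleCat.of B B) := by
  let T : Submodule B B := Submodule.span B {b | ∃ (f : V ⟶ ModuleCat.of B B) (v : V), f.hom v = b}
  have mkQ_eq_zero : ModuleCat.ofHom T.mkQ = 0 := by
    refine (Preadditive.isSeparator_iff V).1 hV _ fun f => ?_
    ext v
    have : f.hom v ∈ T := Submodule.subset_span ⟨f, v, rfl⟩
    simpa using this
  have one_mem : (1 : B) ∈ T := by simpa using congr($(mkQ_eq_zero).hom 1)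
  obtain ⟨n, c, g, hg⟩ := Submodule.mem_span_set'.mp one_mem
  choose f v hfv using fun j => (g j).2
  refine iff_exists_sum_eq_one.2 ⟨n, fun j => (f j).hom, fun j => c j • v j, ?_⟩
  simp only [map_smul, hfv, hg]

end IsRetractOfPower

theorem isSeparator_of_self (B : Type u) [Ring B] : IsSeparator (ModuleCat.of.{u} B B) := by
  rw [Preadditive.isSeparator_iff]
  refine fun X Y f hf => ModuleCat.hom_ext (LinearMap.ext fun x => ?_)
  have := congr($(hf (ModuleCat.ofHom (LinearMap.toSpanSingleton B X x))).hom 1)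
  simpa using this

section FullyFaithful

variable {A : Type u} [Ring A] {D : Type*} [Category.{u} D] [Preadditive D]
  (F : ModuleCat.{u} A ⥤ D) [F.Additive] [F.Full] [F.Faithful]

/-- The endomorphism ring of the image of the free module of rank one under a fully faithful
functor: `op a` acts as the image of the right multiplication by `a`. -/
noncomputable def opRingEquivEndObj : Aᵐᵒᵖ ≃+* End (F.obj (ModuleCat.of A A)) :=
  ((RingEquiv.moduleEndSelf A).trans (ModuleCat.endRingEquiv (ModuleCat.of A A)).symm).trans
    { (Functor.FullyFaithful.ofFullyFaithful F).mulEquivEnd (ModuleCat.of A A) with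
      map_add' := fun _ _ => F.map_add }

theorem essSurj_comp_preadditiveCoyonedaObj :
    (F ⋙ preadditiveCoyonedaObj (F.obj (ModuleCat.of A A))).EssSurj where
  mem_essImage Y := by
    let S := (End (F.obj (ModuleCat.of A A)))ᵐᵒᵖ
    let r : A ≃+* S := (RingEquiv.opOp A).trans (opRingEquivEndObj F).op
    let W := (ModuleCat.restrictScalars (r : A →+* S)).obj Y
    let q : W ≃+ (ModuleCat.of A A ⟶ W) :=
      (ModuleCat.homAddEquiv.trans (LinearMap.ringLmapEquivSelf A ℕ W).toAddEquiv).symm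
    have map_q_smul (a : A) (w : W) : F.map (q (a • w)) = r a • F.map (q w) := by
      refine Eq.trans (congrArg F.map ?_) (F.map_comp _ _)
      refine ModuleCat.hom_ext (LinearMap.ext fun (b : A) => ?_)
      exact (mul_smul b a w).symm
    let e : Y ≃ₗ[S] (F.obj (ModuleCat.of A A) ⟶ F.obj W) :=
      { q.toEquiv.trans (Functor.FullyFaithful.ofFullyFaithful F).homEquiv with
        map_add' w w' := (congrArg F.map (map_add q w w')).trans F.map_add
        map_smul' s w := by
          obtain ⟨a, rfl⟩ := r.surjective s
          exact map_q_smul a w }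
    exact ⟨W, ⟨e.symm.toModuleIso⟩⟩

end FullyFaithful

variable {R : Type*} [CommRing R] {A B : Type u} [Ring A] [Algebra R A] [Ring B] [Algebra R B]

instance preadditiveCoyonedaObj_linear {C : Type*} [Category.{u} C] [Preadditive C] [Linear R C]
    (E : C) : (preadditiveCoyonedaObj E).Linear R where
  map_smul {X Y} f c := by
    ext (g : E ⟶ X)
    change g ≫ (c • f) = (c • 𝟙 E) ≫ g ≫ f
    rw [Linear.smul_comp, Category.id_comp, Linear.comp_smul]

/-- `E` is finitely generated projective and its trace ideal is all of `B`. -/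
structure IsProgenerator (B E : Type*) [Ring B] [AddCommGroup E] [Module B E] : Prop where
  exists_dual_basis :
    ∃ (n : ℕ) (φ : Fin n → E →ₗ[B] B) (y : Fin n → E), ∀ x, ∑ i, φ i x • y i = x
  exists_sum_eq_one :
    ∃ (n : ℕ) (g : Fin n → E →ₗ[B] B) (w : Fin n → E), ∑ j, g j (w j) = 1

theorem isEquivalence_preadditiveCoyonedaObj {E : ModuleCat.{u} B} (hE : IsProgenerator B E) :
    (preadditiveCoyonedaObj E).IsEquivalence := by
  have isSeparator_E : IsSeparator E :=
    (IsRetractOfPower.iff_exists_sum_eq_one.2 hE.exists_sum_eq_one).isSeparator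
      (isSeparator_of_self B)
  let F := preadditiveCoyonedaObj E
  have : F.Faithful := (isSeparator_iff_faithful_preadditiveCoyonedaObj _).1 isSeparator_E
  have : F.Full := IsGrothendieckAbelian.GabrielPopescu.full E isSeparator_E
  let P := F.obj (ModuleCat.of B B)
  have isSeparator_P : IsSeparator P := by
    let e : F.obj E ≅ ModuleCat.of (End E)ᵐᵒᵖ (End E)ᵐᵒᵖ := LinearEquiv.toModuleIso
      { MulOpposite.opAddEquiv with map_smul' := fun _ _ => rfl }
    have h := (IsRetractOfPower.iff_exists_dual_basis.2 hE.exists_dual_basis).map F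
    exact (h.of_iso (Iso.refl P) e).isSeparator (isSeparator_of_self _)
  let G := preadditiveCoyonedaObj P
  have : G.Faithful := (isSeparator_iff_faithful_preadditiveCoyonedaObj _).1 isSeparator_P
  have : G.Full := IsGrothendieckAbelian.GabrielPopescu.full P isSeparator_P
  have : (F ⋙ G).EssSurj := essSurj_comp_preadditiveCoyonedaObj F
  have : F.EssSurj := Functor.essSurj_of_comp_fully_faithful F G
  exact {}

theorem isMoritaEquivalent_end (R : Type*) [CommRing R] {B : Type u} [Ring B] [Algebra R B]
    {E : ModuleCat.{u} B} (hE : IsProgenerator B E) :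
    IsMoritaEquivalent R B (End E)ᵐᵒᵖ := by
  have := isEquivalence_preadditiveCoyonedaObj hE
  exact ⟨⟨(preadditiveCoyonedaObj E).asEquivalence, preadditiveCoyonedaObj_linear E⟩⟩

/-- Endomorphisms in the category of modules are linear endomorphisms. -/
def endAlgEquivModuleEnd (R : Type*) [CommRing R] {B : Type u} [Ring B] [Algebra R B]
    (E : ModuleCat.{u} B) : End E ≃ₐ[R] Module.End B E :=
  AlgEquiv.ofRingEquiv (f := ModuleCat.endRingEquiv E) fun _ => rfl

/-- `opRingEquivEndObj` for a linear functor. -/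
noncomputable def opAlgEquivEndObj (F : ModuleCat.{u} A ⥤ ModuleCat.{u} B) [F.Additive]
    [F.Linear R] [F.Full] [F.Faithful] : Aᵐᵒᵖ ≃ₐ[R] End (F.obj (ModuleCat.of A A)) :=
  AlgEquiv.ofRingEquiv (f := opRingEquivEndObj F) fun c => by
    refine Eq.trans (congrArg F.map ?_)
      ((F.map_smul c (𝟙 (ModuleCat.of A A))).trans (congrArg (c • ·) (F.map_id _)))
    refine ModuleCat.hom_ext (LinearMap.ext fun (a : A) => ?_)
    exact (Algebra.commutes c a).symm

theorem isMoritaEquivalent_of_isProgenerator {E : Type u} [AddCommGroup E] [Module R E]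
    [Module B E] [IsScalarTower R B E] (hE : IsProgenerator B E)
    (ρ : Aᵐᵒᵖ ≃ₐ[R] Module.End B E) : IsMoritaEquivalent R A B := by
  let E' := ModuleCat.of B E
  have ρ' : Aᵐᵒᵖ ≃ₐ[R] End E' := AlgEquiv.ofRingEquiv
    (f := (ρ : Aᵐᵒᵖ ≃+* Module.End B E).trans (ModuleCat.endRingEquiv E').symm) fun c => by
      refine ModuleCat.hom_ext (LinearMap.ext fun (x : E) => ?_)
      exact (LinearMap.congr_fun (ρ.commutes c) x).trans (algebraMap_smul B c x).symm
  exact (IsMoritaEquivalent.of_algEquiv R ((AlgEquiv.opOp R A).trans (AlgEquiv.op ρ'))).trans R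
    (isMoritaEquivalent_end R (E := E') hE).symm

theorem exists_isProgenerator_of_isMoritaEquivalent (h : IsMoritaEquivalent R A B) :
    ∃ E : ModuleCat.{u} B, IsProgenerator B E ∧ Nonempty (Aᵐᵒᵖ ≃ₐ[R] Module.End B E) := by
  obtain ⟨⟨e⟩⟩ := h
  let F := e.eqv.functor
  have : F.Linear R := e.linear
  have isSeparator_inverse : IsSeparator (e.eqv.inverse.obj (ModuleCat.of B B)) :=
    (isSeparator_of_self B).of_equivalence e.eqv.symm
  have isSeparator_functor : IsSeparator (F.obj (ModuleCat.of A A)) :=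
    (isSeparator_of_self A).of_equivalence e.eqv
  refine ⟨F.obj (ModuleCat.of A A), ⟨?_, ?_⟩,
    ⟨(opAlgEquivEndObj F).trans (endAlgEquivModuleEnd R _)⟩⟩
  · refine IsRetractOfPower.iff_exists_dual_basis.1 ?_
    exact ((IsRetractOfPower.of_isSeparator isSeparator_inverse).map F).of_iso
      (e.eqv.counitIso.app _) (Iso.refl _)
  · exact IsRetractOfPower.iff_exists_sum_eq_one.1 (.of_isSeparator isSeparator_functor)

end Morita

namespace StrongEquivalenceBimodule

variable {A B E : Type u} [Ring A] [Algebra ℂ⟦X⟧ A] [StarRing A] [Ring B] [Algebra ℂ⟦X⟧ B]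
  [StarRing B] [AddCommGroup E] [Module ℂ⟦X⟧ E] [Module B E] [Module Aᵐᵒᵖ E]
  (σ : StrongEquivalenceBimodule B A E)

include σ

theorem exists_sum_innerA_eq_one :
    ∃ (n : ℕ) (v w : Fin n → E), ∑ i, σ.innerA (v i) (w i) = 1 := by
  obtain ⟨n, c, a, ha⟩ := Submodule.mem_span_set'.1 (σ.fullA ▸ Submodule.mem_top (x := (1 : A)))
  choose v w hvw using fun i => (a i).2
  exact ⟨n, v, fun i => c i • w i, by simp only [map_smul, hvw, ha]⟩

theorem exists_sum_innerB_eq_one :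
    ∃ (n : ℕ) (v w : Fin n → E), ∑ i, σ.innerB (v i) (w i) = 1 := by
  obtain ⟨n, c, b, hb⟩ := Submodule.mem_span_set'.1 (σ.fullB ▸ Submodule.mem_top (x := (1 : B)))
  choose v w hvw using fun i => (b i).2
  exact ⟨n, fun i => c i • v i, w, by simp only [map_smul, LinearMap.smul_apply, hvw, hb]⟩

theorem isProgenerator : IsProgenerator B E where
  exists_dual_basis := by
    obtain ⟨n, v, w, hvw⟩ := σ.exists_sum_innerA_eq_one
    refine ⟨n, fun i => { σ.innerB.flip (v i) with map_smul' := fun b x => ?_ }, w, fun x => ?_⟩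
    · exact σ.innerB_smul_left b x (v i)
    · calc ∑ i, σ.innerB x (v i) • w i = op (∑ i, σ.innerA (v i) (w i)) • x := by
            simp only [σ.compatible, Finset.op_sum, Finset.sum_smul]
        _ = x := by rw [hvw, MulOpposite.op_one, one_smul]
  exists_sum_eq_one := by
    obtain ⟨n, v, w, hvw⟩ := σ.exists_sum_innerB_eq_one
    exact ⟨n, fun i => { σ.innerB.flip (w i) with
      map_smul' := fun b x => σ.innerB_smul_left b x (w i) }, v, hvw⟩

theorem bijective_toModuleEnd [SMulCommClass Aᵐᵒᵖ B E] :
    Function.Bijective (Module.toModuleEnd B (S := Aᵐᵒᵖ) E) := by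
  obtain ⟨n, v, w, hvw⟩ := σ.exists_sum_innerA_eq_one
  refine ⟨(injective_iff_map_eq_zero _).2 fun a ha => ?_,
    fun T => ⟨op (∑ i, σ.innerA (v i) (T (w i))), ?_⟩⟩
  · have smul_eq_zero (x : E) : a • x = 0 := LinearMap.congr_fun ha x
    have key : a.unop = 0 := calc
      a.unop = ∑ i, σ.innerA (v i) (a • w i) := by
        rw [← one_mul a.unop, ← hvw, Finset.sum_mul]
        exact Finset.sum_congr rfl fun i _ => (σ.innerA_smul_right _ _ _).symm
      _ = 0 := by simp only [smul_eq_zero, map_zero, Finset.sum_const_zero]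
    exact MulOpposite.unop_injective key
  · ext x
    calc op (∑ i, σ.innerA (v i) (T (w i))) • x = ∑ i, σ.innerB x (v i) • T (w i) := by
          simp only [Finset.op_sum, Finset.sum_smul, σ.compatible]
      _ = T (op (∑ i, σ.innerA (v i) (w i)) • x) := by
          simp only [Finset.op_sum, Finset.sum_smul, ← σ.compatible, map_sum, map_smul]
      _ = T x := by rw [hvw, MulOpposite.op_one, one_smul]

theorem isMoritaEquivalent [IsScalarTower ℂ⟦X⟧ B E] [IsScalarTower ℂ⟦X⟧ Aᵐᵒᵖ E]
    [SMulCommClass B Aᵐᵒᵖ E] : IsMoritaEquivalent ℂ⟦X⟧ A B := by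
  have := SMulCommClass.symm B Aᵐᵒᵖ E
  refine isMoritaEquivalent_of_isProgenerator σ.isProgenerator (AlgEquiv.ofRingEquiv
    (f := RingEquiv.ofBijective (Module.toModuleEnd B (S := Aᵐᵒᵖ) E) σ.bijective_toModuleEnd)
    fun c => LinearMap.ext fun x => ?_)
  exact algebraMap_smul Aᵐᵒᵖ c x

end StrongEquivalenceBimodule

/-! ## Star products -/

section StarProducts

variable {n : ℕ} {M : Type u} [TopologicalSpace M]
  [ChartedSpace (EuclideanSpace ℝ (Fin n)) M] {P : PoissonStructure n M}

theorem constantCoeff_star {R : Type*} [CommRing R] [StarRing R] (f : R⟦X⟧) :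
    PowerSeries.constantCoeff (star f) = star (PowerSeries.constantCoeff f) := by
  simp only [← PowerSeries.coeff_zero_eq_constantCoeff_apply, PowerSeries.coeff_star]

theorem constantCoeff_smul {A : Type*} [CommRing A] [Algebra ℂ A] (c : ℂ⟦X⟧) (f : A⟦X⟧) :
    PowerSeries.constantCoeff (c • f) =
      PowerSeries.constantCoeff c • PowerSeries.constantCoeff f := by
  rw [Algebra.smul_def, Algebra.smul_def, map_mul, PowerSeries.algebraMap_apply'']
  simp only [← PowerSeries.coeff_zero_eq_constantCoeff_apply, PowerSeries.coeff_map]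

theorem isSMulRegular_X {A : Type*} [CommRing A] [Algebra ℂ A] :
    IsSMulRegular A⟦X⟧ (PowerSeries.X : ℂ⟦X⟧) := by
  intro f g h
  simpa only [PowerSeries.X_smul_formal, PowerSeries.X_mul_inj] using h

theorem isAdicComplete_powerSeries {A : Type*} [CommRing A] [Algebra ℂ A] :
    IsAdicComplete (Ideal.span {(PowerSeries.X : ℂ⟦X⟧)}) A⟦X⟧ := by
  rw [← IsAdicComplete.map_algebraMap_iff (S := A⟦X⟧), Ideal.map_span, Set.image_singleton,
    PowerSeries.algebraMap_apply'', PowerSeries.map_X]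
  infer_instance

namespace StarProduct

theorem constantCoeff_one (S : StarProduct P) :
    PowerSeries.constantCoeff (R := SmoothFun n M) (1 : S.Alg) = 1 := by
  have h := S.constantCoeff_mul (1 : S.Alg) (1 : (SmoothFun n M)⟦X⟧)
  rw [show S.mul (1 : S.Alg) (1 : (SmoothFun n M)⟦X⟧) = 1 from one_mul (M := S.Alg) _,
    map_one, mul_one] at h
  exact h.symm

/-- The classical limit `f ↦ f mod λ` of a star product algebra. -/
noncomputable def cl (S : StarProduct P) : S.Alg →+* SmoothFun n M where
  toFun f := PowerSeries.constantCoeff (R := SmoothFun n M) f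
  map_one' := S.constantCoeff_one
  map_mul' := S.constantCoeff_mul
  map_zero' := map_zero (PowerSeries.constantCoeff (R := SmoothFun n M))
  map_add' := map_add (PowerSeries.constantCoeff (R := SmoothFun n M))

end StarProduct

theorem HermitianStarProduct.isFormalDeformation (S : HermitianStarProduct P) :
    IsFormalDeformation S.cl where
  isAdicComplete := isAdicComplete_powerSeries (A := SmoothFun n M)
  isSMulRegular := isSMulRegular_X (A := SmoothFun n M)
  surjective f := ⟨PowerSeries.C f, PowerSeries.constantCoeff_C f⟩
  map_smul := constantCoeff_smul (A := SmoothFun n M)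
  exists_eq_smul f hf := by
    obtain ⟨g, hg⟩ := PowerSeries.eq_C_add_X_smul (A := SmoothFun n M) f
    have hf : PowerSeries.constantCoeff (R := SmoothFun n M) f = 0 := hf
    rw [hf, map_zero, zero_add] at hg
    exact ⟨g, hg⟩
  map_star := constantCoeff_star (R := SmoothFun n M)

end StarProducts

section MainTheorem

variable {A B : Type u} [Ring A] [Algebra ℂ⟦X⟧ A] [StarRing A] [StarModule ℂ⟦X⟧ A] [Ring B]
  [Algebra ℂ⟦X⟧ B] [StarRing B] [StarModule ℂ⟦X⟧ B] {C D : Type*} [CommRing C] [StarRing C]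
  [Algebra ℂ C] [HasEnoughStarCharacters C] [CommRing D] [StarRing D] [Algebra ℂ D]
  [HasEnoughStarCharacters D] {clA : A →+* C} {clB : B →+* D}

theorem IsProgenerator.stronglyMoritaEquivalent {E : Type u} [AddCommGroup E] [Module ℂ⟦X⟧ E]
    [Module B E] [IsScalarTower ℂ⟦X⟧ B E] (hA : IsFormalDeformation clA)
    (hB : IsFormalDeformation clB) (hE : IsProgenerator B E)
    (φ : A ≃ₐ[ℂ⟦X⟧] (Module.End B E)ᵐᵒᵖ) : StronglyMoritaEquivalent A B := by
  have := HasEnoughStarCharacters.isReduced D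
  obtain ⟨r, f, y, hfy⟩ := hE.exists_dual_basis
  obtain ⟨H⟩ := HermitianDualBasis.nonempty_of_dual_basis hB.isUnit_one_add_mul_conjTranspose
    f y hfy
  obtain ⟨m, g, w, hgw⟩ := hE.exists_sum_eq_one
  choose v hv using fun j => H.exists_form_eq (g j)
  have hvw : ∑ j, H.form (v j) (w j) = 1 := by simpa only [hv] using hgw
  obtain ⟨κ, hκ⟩ := H.exists_ringHom_of_mul_comm_smodEq hB hvw (hA.mul_comm_smodEq_of_algEquiv φ)
  obtain ⟨q, hq⟩ := H.exists_sum_form_eq_one hB (H.cl_sum_form_vec hκ hvw)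
  obtain ⟨ψ, hψ⟩ := H.exists_algEquiv_map_star hA hB hvw hκ φ
  exact H.stronglyMoritaEquivalent hψ hq

open scoped ModuleCat.Algebra in
theorem mainTheorem5_general (hA : IsFormalDeformation clA) (hB : IsFormalDeformation clB) :
    StronglyMoritaEquivalent A B ↔ IsMoritaEquivalent ℂ⟦X⟧ A B := by
  refine ⟨fun ⟨_, _, _, _, _, _, _, _, ⟨σ⟩⟩ => σ.isMoritaEquivalent, fun h => ?_⟩
  obtain ⟨E, hE, ⟨ρ⟩⟩ := exists_isProgenerator_of_isMoritaEquivalent h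
  exact hE.stronglyMoritaEquivalent hA hB (AlgEquiv.opComm.symm ρ)

end MainTheorem

theorem mainTheorem5 {n : ℕ} {M : Type u} [TopologicalSpace M] [T2Space M]
    [SecondCountableTopology M] [ChartedSpace (EuclideanSpace ℝ (Fin n)) M]
    [IsManifold (𝓡 n) ∞ M] (P : PoissonStructure n M) (S S' : HermitianStarProduct P) :
    StronglyMoritaEquivalent S.Alg S'.Alg ↔ IsMoritaEquivalent ℂ⟦X⟧ S.Alg S'.Alg := by
  exact mainTheorem5_general S.isFormalDeformation S'.isFormalDeformation
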